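/- **Setting.** Let $A$ be an $m\times n$ integer matrix, $n\ge 1$. For $u,v\in\mathbb Z^n$ write $u\sqsubseteq v$ if $u_iv_i\ge 0$ and $|u_i|\le|v_i|$ for all $i$. The Graver basis $\mathcal G(A)$ is the set of $\sqsubseteq$-minimal elements of $\{v\in\mathbb Z^n: Av=0,\ v\neq 0\}$. Let $g_\infty\ge 0$ be an integer with $\|v\|_\infty\le g_\infty$ for all $v\in\mathcal G(A)$, and let $\mathcal L=\{v\in\mathbb Z^n: Av=0,\ \|v\|_\infty\le g_\infty\}$. The column graph $G(A)$ has vertex set $\{1,\dots,n\}$, with an edge between $j_1\ne j_2$ if $A_{i,j_1}A_{i,j_2}\ne 0$ for some $i$. Let $\kappa$ be the treewidth of $G(A)$, that is, the minimum of (clique number of $H$) $-\,1$ over all chordal graphs $H\supseteq G(A)$ on the same vertices, where a graph is chordal if its vertices have a perfect elimination ordering $(v_1,\dots,v_n)$, i.e. one in which each set $X_l=\{v_l\}\cup\{v_k: k>l,\ v_k \text{ adjacent to } v_l\}$ is a clique. Running time is the number of operations of a random access machine working on integers, with additions, subtractions, comparisons, and reads and writes of memory (with indirect addressing) at unit cost.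 **Theorem.** There are two fixed programs, *Prep* and *Test*, and an absolute constant $C$ such that the following holds for all $A$ and $g_\infty$ as above and for every chordal graph $H\supseteq G(A)$ of clique number $\kappa+1$ with a perfect elimination ordering $(v_1,\dots,v_n)$. 1. Given $A$ (as the lists of the nonzero entries of its rows), $g_\infty$, the ordering $(v_1,\dots,v_n)$ and the sets $X_1,\dots,X_n$, the program *Prep*, which does not depend on a vector to be tested, halts after at most $C\,(m+n)\,(2g_\infty+1)^{\kappa+1}$ operations. 2. For every $z\in\mathbb Z^n$, the program *Test*, started on the memory that *Prep* has left together with $z$, halts after at most $C\,n\,(2g_\infty+1)^{\kappa+1}$ operations and correctly answers whether $z\in\mathcal G(A)$. 3. For every $z\in\mathbb Z^n$, one has $z\in\mathcal G(A)$ if and only if $z\ne 0$ and $\{v\in\mathcal L: v\sqsubseteq z\}=\{0,z\}$. In particular, if $m\le n$, then membership of a vector in $\mathcal G(A)$ is decided, including the preprocessing, in time $O(n\,(2g_\infty+1)^{\kappa+1})$. -/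

import Mathlib

namespace ToricGraver

/-! ### Graphs: perfect elimination orderings, chordal completions, treewidth -/

/-- For an ordering `σ 0, σ 1, …, σ (n-1)` of the vertices of `G`, the set consisting of `σ l`
and of its neighbours that come later in the ordering. -/
def elimSet {n : ℕ} (G : SimpleGraph (Fin n)) (σ : Equiv.Perm (Fin n)) (l : Fin n) :
    Set (Fin n) :=
  {v | ∃ k : Fin n, v = σ k ∧ (k = l ∨ (l < k ∧ G.Adj (σ l) (σ k)))}

/-- The ordering `σ` is a perfect elimination ordering of `G`. -/
def IsPerfectElimination {n : ℕ} (G : SimpleGraph (Fin n)) (σ : Equiv.Perm (Fin n)) : Prop :=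
  ∀ l : Fin n, G.IsClique (elimSet G σ l)

/-- A graph is chordal if it has a perfect elimination ordering. -/
def IsChordal {n : ℕ} (G : SimpleGraph (Fin n)) : Prop :=
  ∃ σ : Equiv.Perm (Fin n), IsPerfectElimination G σ

/-- `H` is a chordal completion of `G`. -/
def IsChordalCompletion {n : ℕ} (G H : SimpleGraph (Fin n)) : Prop :=
  IsChordal H ∧ G ≤ H

/-- The treewidth: the minimum of (clique number) - 1 over all chordal completions
(of interest for `0 < n`; the complete graph is always a chordal completion). -/
noncomputable def treewidth {n : ℕ} (G : SimpleGraph (Fin n)) : ℕ :=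
  sInf {k : ℕ | ∃ H : SimpleGraph (Fin n), IsChordalCompletion G H ∧ H.cliqueNum = k + 1}

/-- The column graph of a matrix: two distinct columns are adjacent if some row is nonzero in
both of them. -/
def columnGraph {m n : ℕ} (A : Matrix (Fin m) (Fin n) ℤ) : SimpleGraph (Fin n) where
  Adj j k := j ≠ k ∧ ∃ i, A i j * A i k ≠ 0
  symm := ⟨fun _ _ h => ⟨h.1.symm, h.2.imp fun _ hi => by rwa [mul_comm]⟩⟩
  loopless := ⟨fun _ h => h.1 rfl⟩

/-! ### Graver bases -/

/-- The conformal order `u ⊑ v` on integer vectors. -/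
def Conformal {n : ℕ} (u v : Fin n → ℤ) : Prop :=
  ∀ i, 0 ≤ u i * v i ∧ |u i| ≤ |v i|

/-- The Graver basis of `A`: the `⊑`-minimal nonzero integer vectors in the kernel of `A`. -/
def graverBasis {m n : ℕ} (A : Matrix (Fin m) (Fin n) ℤ) : Set (Fin n → ℤ) :=
  {v | A.mulVec v = 0 ∧ v ≠ 0 ∧
    ∀ u : Fin n → ℤ, A.mulVec u = 0 → u ≠ 0 → Conformal u v → u = v}

/-- The integer vectors in the kernel of `A` all of whose entries have absolute value `≤ g`. -/
def boundedKernel {m n : ℕ} (A : Matrix (Fin m) (Fin n) ℤ) (g : ℕ) : Set (Fin n → ℤ) :=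
  {v | A.mulVec v = 0 ∧ ∀ j, |v j| ≤ (g : ℤ)}

/-! ### A random access machine

Programs are finite texts of a `while` language over integer registers and integer arrays (a
program mentions finitely many of each). The operations are addition, subtraction, comparison
and indirect addressing, each at unit cost. There is no multiplication, so a single operation
can at most double the largest absolute value in memory. -/

/-- Integer expressions. `read a e` is the entry of array `a` at the address `e`. -/
inductive Expr where
  | const (c : ℤ)
  | reg (x : ℕ)
  | read (a : ℕ) (e : Expr)
  | add (e₁ e₂ : Expr)
  | sub (e₁ e₂ : Expr)

/-- Programs. `ite e₁ e₂ c₁ c₂` branches on `e₁ < e₂`, and `while e₁ e₂ c` repeats `c` as long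
as `e₁ < e₂`. -/
inductive Prog where
  | skip
  | assign (x : ℕ) (e : Expr)
  | write (a : ℕ) (addr e : Expr)
  | seq (c₁ c₂ : Prog)
  | ite (e₁ e₂ : Expr) (c₁ c₂ : Prog)
  | while (e₁ e₂ : Expr) (c : Prog)

/-- The memory: the contents of the registers and of the arrays. -/
structure Memory where
  reg : ℕ → ℤ
  arr : ℕ → ℤ → ℤ

/-- Store an integer in a register. -/
def Memory.setReg (M : Memory) (x : ℕ) (v : ℤ) : Memory :=
  { M with reg := Function.update M.reg x v }

/-- Replace the contents of a whole array. -/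
def Memory.setArr (M : Memory) (a : ℕ) (f : ℤ → ℤ) : Memory :=
  { M with arr := Function.update M.arr a f }

/-- The value of an expression. -/
def Expr.eval (M : Memory) : Expr → ℤ
  | .const c => c
  | .reg x => M.reg x
  | .read a e => M.arr a (e.eval M)
  | .add e₁ e₂ => e₁.eval M + e₂.eval M
  | .sub e₁ e₂ => e₁.eval M - e₂.eval M

/-- The number of steps for evaluating an expression: its number of nodes. -/
def Expr.cost : Expr → ℕ
  | .const _ => 1
  | .reg _ => 1
  | .read _ e => e.cost + 1
  | .add e₁ e₂ => e₁.cost + e₂.cost + 1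
  | .sub e₁ e₂ => e₁.cost + e₂.cost + 1

/-- `Runs c M M' t`: started on the memory `M`, the program `c` halts after exactly `t` steps
and leaves the memory `M'`. -/
inductive Runs : Prog → Memory → Memory → ℕ → Prop where
  | skip (M : Memory) : Runs .skip M M 1
  | assign (x : ℕ) (e : Expr) (M : Memory) :
      Runs (.assign x e) M (M.setReg x (e.eval M)) (e.cost + 1)
  | write (a : ℕ) (addr e : Expr) (M : Memory) :
      Runs (.write a addr e) M
        (M.setArr a (Function.update (M.arr a) (addr.eval M) (e.eval M)))
        (addr.cost + e.cost + 1)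
  | seq {c₁ c₂ : Prog} {M M₁ M₂ : Memory} {t₁ t₂ : ℕ} :
      Runs c₁ M M₁ t₁ → Runs c₂ M₁ M₂ t₂ → Runs (.seq c₁ c₂) M M₂ (t₁ + t₂)
  | iteTrue {e₁ e₂ : Expr} {c₁ c₂ : Prog} {M M' : Memory} {t : ℕ} :
      e₁.eval M < e₂.eval M → Runs c₁ M M' t →
      Runs (.ite e₁ e₂ c₁ c₂) M M' (e₁.cost + e₂.cost + 1 + t)
  | iteFalse {e₁ e₂ : Expr} {c₁ c₂ : Prog} {M M' : Memory} {t : ℕ} :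
      ¬ e₁.eval M < e₂.eval M → Runs c₂ M M' t →
      Runs (.ite e₁ e₂ c₁ c₂) M M' (e₁.cost + e₂.cost + 1 + t)
  | whileDone {e₁ e₂ : Expr} {c : Prog} {M : Memory} :
      ¬ e₁.eval M < e₂.eval M → Runs (.while e₁ e₂ c) M M (e₁.cost + e₂.cost + 1)
  | whileStep {e₁ e₂ : Expr} {c : Prog} {M M₁ M₂ : Memory} {t₁ t₂ : ℕ} :
      e₁.eval M < e₂.eval M → Runs c M M₁ t₁ → Runs (.while e₁ e₂ c) M₁ M₂ t₂ →
      Runs (.while e₁ e₂ c) M M₂ (e₁.cost + e₂.cost + 1 + t₁ + t₂)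

/-! ### Encoding of the input -/

/-- The array with the entries of the list `l` at the addresses `0, 1, …`, and `0` elsewhere. -/
def listArr (l : List ℤ) : ℤ → ℤ :=
  fun i => if 0 ≤ i then l.getD i.toNat 0 else 0

/-- The start addresses of the lists `L₀, L₁, …` in their concatenation, followed by the total
length. -/
def offsets (L : List (List ℤ)) : List ℤ :=
  (List.range (L.length + 1)).map fun i => ((L.take i).flatten.length : ℤ)

/-- A vector as an array. -/
def vecArr {n : ℕ} (z : Fin n → ℤ) : ℤ → ℤ :=
  listArr (List.ofFn z)

/-- The columns at which row `i` is nonzero, in increasing order. -/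
def rowSupport {m n : ℕ} (A : Matrix (Fin m) (Fin n) ℤ) (i : Fin m) : List (Fin n) :=
  (List.finRange n).filter fun j => A i j ≠ 0

open Classical in
/-- The vertices of `elimSet H σ l`, in the order given by `σ` (so `σ l` comes first). -/
noncomputable def elimList {n : ℕ} (H : SimpleGraph (Fin n)) (σ : Equiv.Perm (Fin n))
    (l : Fin n) : List (Fin n) :=
  ((List.finRange n).filter fun k => k = l ∨ (l < k ∧ H.Adj (σ l) (σ k))).map σ

/-- The memory that holds the bound `g`, the matrix `A` in sparse row format, and a graph `H` with
an ordering `σ` of its vertices; everything else is zero.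

* Registers `0, 1, 2`: the numbers `n`, `m` and `g`.
* Arrays `0, 1, 2`: the nonzero entries of `A` row by row (start of each row, column indices,
  values).
* Array `3`: the ordering of the vertices.
* Arrays `4, 5`: for each `l`, the list of the vertices in `elimSet H σ l` (start of each list,
  vertices). -/
noncomputable def inputMemory {m n : ℕ} (A : Matrix (Fin m) (Fin n) ℤ) (g : ℕ)
    (H : SimpleGraph (Fin n)) (σ : Equiv.Perm (Fin n)) : Memory where
  reg x :=
    match x with
    | 0 => n
    | 1 => m
    | 2 => g
    | _ => 0
  arr a :=
    match a with
    | 0 => listArr (offsets (List.ofFn fun i => (rowSupport A i).map fun j => (j.val : ℤ)))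
    | 1 => listArr (List.ofFn fun i => (rowSupport A i).map fun j => (j.val : ℤ)).flatten
    | 2 => listArr (List.ofFn fun i => (rowSupport A i).map fun j => A i j).flatten
    | 3 => vecArr fun l => ((σ l).val : ℤ)
    | 4 => listArr (offsets (List.ofFn fun l => (elimList H σ l).map fun j => (j.val : ℤ)))
    | 5 => listArr (List.ofFn fun l => (elimList H σ l).map fun j => (j.val : ℤ)).flatten
    | _ => fun _ => 0

/-- The array in which the vector to be tested is placed. -/
def queryArr : ℕ := 6

/-- The register in which the answer is returned. -/
def answerReg : ℕ := 3

end ToricGraver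

/-! Minimality of z is reduced to two maximization problems. Call a kernel vector with entries in
[-g, g] feasible if it is conformal to z, and maximize the ℓ₁-norm over the feasible vectors. A
feasible v has norm at most ‖z‖₁, with equality only for v = z, so the optimum reaches ‖z‖₁ exactly
when z itself is feasible. For such z ≠ 0, fix J with z_J ≠ 0 and forbid v_J = z_J. If u ⊑ z is a
kernel vector other than 0 and z, then so is z - u, and one of the two differs from z at J, since
u_J = z_J gives (z - u)_J = 0. Hence z is minimal exactly when the second optimum is less than 1
(`mem_graverBasis_iff_optima`).

Both problems become unconstrained: each violated row, and each entry that is nonconformal or has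
the forbidden value, costs n g + 1, which exceeds the n g that all entries together can contribute.
So a nonnegative total certifies feasibility (`feasible_of_total_nonneg`).

The objective is now a sum of functions of single variables and of row supports. The support of a
row is a clique, hence lies in the bag of its first vertex in the elimination ordering
(`wp_loadRow`); the row penalties therefore fit into tables with N^|bag| entries, N = 2 g + 1, which
do not depend on z. Variables are then maximized out in the given order. Later bags do not contain
the eliminated vertex (`not_mem_bag`), so the maximum only involves its own table and weight
(`value_update`). It is a function of the other vertices of the bag, and these all lie in the bag of
the earliest of them (`tail_subset_parent`), whose table absorbs it. An empty bag with number n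
serves as root, and its single entry ends up as the optimum (`wp_maximize`). Bags are cliques
(`length_bag_le_cliqueNum`), so each of the n steps costs O(N^(κ+1)).

The machine neither multiplies nor divides. Linear functions of base N digits are tabulated by
additions only (`wp_fill`); this yields both the values of the rows and the addresses in the
messages. -/

namespace ToricGraver

/-! ### Weakest preconditions -/

/-- The registers that a program may write to. -/
def Prog.regs : Prog → List ℕ
  | .skip => []
  | .assign x _ => [x]
  | .write _ _ _ => []
  | .seq c₁ c₂ => c₁.regs ++ c₂.regs
  | .ite _ _ c₁ c₂ => c₁.regs ++ c₂.regs
  | .while _ _ c => c.regs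

/-- The arrays that a program may write to. -/
def Prog.arrs : Prog → List ℕ
  | .skip => []
  | .assign _ _ => []
  | .write a _ _ => [a]
  | .seq c₁ c₂ => c₁.arrs ++ c₂.arrs
  | .ite _ _ c₁ c₂ => c₁.arrs ++ c₂.arrs
  | .while _ _ c => c.arrs

/-- The memories agree outside the registers and arrays that `c` may write to. -/
structure Same (c : Prog) (M M' : Memory) : Prop where
  reg : ∀ x, x ∉ c.regs → M'.reg x = M.reg x
  arr : ∀ a, a ∉ c.arrs → M'.arr a = M.arr a

theorem Same.refl (c : Prog) (M : Memory) : Same c M M := ⟨fun _ _ => rfl, fun _ _ => rfl⟩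

theorem Same.trans {c : Prog} {M M' M'' : Memory} (h : Same c M M') (h' : Same c M' M'') :
    Same c M M'' :=
  ⟨fun x hx => (h'.reg x hx).trans (h.reg x hx), fun x hx => (h'.arr x hx).trans (h.arr x hx)⟩

@[simp] theorem reg_setReg (M : Memory) (x y : ℕ) (v : ℤ) :
    (M.setReg x v).reg y = if y = x then v else M.reg y := by
  simp [Memory.setReg, Function.update_apply]

@[simp] theorem arr_setReg (M : Memory) (x : ℕ) (v : ℤ) : (M.setReg x v).arr = M.arr := rfl

@[simp] theorem arr_setArr (M : Memory) (a b : ℕ) (f : ℤ → ℤ) :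
    (M.setArr a f).arr b = if b = a then f else M.arr b := by
  simp [Memory.setArr, Function.update_apply]

@[simp] theorem reg_setArr (M : Memory) (a : ℕ) (f : ℤ → ℤ) : (M.setArr a f).reg = M.reg := rfl

/-- The frame rule. Which registers and arrays a program writes to is a decidable property of its
text, so loop invariants only have to mention what changes. -/
theorem Runs.same {c : Prog} {M M' : Memory} {t : ℕ} (h : Runs c M M' t) : Same c M M' := by
  induction h with
  | skip => exact .refl _ _
  | assign => constructor <;> simp +contextual [Prog.regs]
  | write => constructor <;> simp +contextual [Prog.arrs]
  | seq _ _ h₁ h₂ =>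
    constructor
    · intro x hx
      simp only [Prog.regs, List.mem_append, not_or] at hx
      rw [h₂.reg x hx.2, h₁.reg x hx.1]
    · intro x hx
      simp only [Prog.arrs, List.mem_append, not_or] at hx
      rw [h₂.arr x hx.2, h₁.arr x hx.1]
  | iteTrue _ _ h =>
    constructor
    · intro x hx
      simp only [Prog.regs, List.mem_append, not_or] at hx
      exact h.reg x hx.1
    · intro x hx
      simp only [Prog.arrs, List.mem_append, not_or] at hx
      exact h.arr x hx.1
  | iteFalse _ _ h =>
    constructor
    · intro x hx
      simp only [Prog.regs, List.mem_append, not_or] at hx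
      exact h.reg x hx.2
    · intro x hx
      simp only [Prog.arrs, List.mem_append, not_or] at hx
      exact h.arr x hx.2
  | whileDone => exact .refl _ _
  | whileStep _ _ _ h₁ h₂ =>
    exact ⟨fun x hx => (h₂.reg x hx).trans (h₁.reg x hx),
      fun x hx => (h₂.arr x hx).trans (h₁.arr x hx)⟩

/-- Started on `M`, the program `c` halts with a memory and a number of steps that satisfy `Q`. -/
def WP (c : Prog) (M : Memory) (Q : Memory → ℕ → Prop) : Prop :=
  ∃ M' t, Runs c M M' t ∧ Q M' t

theorem WP.mono {c : Prog} {M : Memory} {Q Q' : Memory → ℕ → Prop} (h : WP c M Q)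
    (hQ : ∀ M' t, Same c M M' → Q M' t → Q' M' t) : WP c M Q' := by
  obtain ⟨M', t, h, h'⟩ := h
  exact ⟨M', t, h, hQ _ _ h.same h'⟩

@[simp] theorem wp_skip {M : Memory} {Q : Memory → ℕ → Prop} : WP .skip M Q ↔ Q M 1 := by
  constructor
  · rintro ⟨_, _, h, hQ⟩
    cases h
    exact hQ
  · exact fun h => ⟨_, _, .skip M, h⟩

@[simp] theorem wp_assign {x : ℕ} {e : Expr} {M : Memory} {Q : Memory → ℕ → Prop} :
    WP (.assign x e) M Q ↔ Q (M.setReg x (e.eval M)) (e.cost + 1) := by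
  constructor
  · rintro ⟨_, _, h, hQ⟩
    cases h
    exact hQ
  · exact fun h => ⟨_, _, .assign x e M, h⟩

@[simp] theorem wp_write {a : ℕ} {e₁ e₂ : Expr} {M : Memory} {Q : Memory → ℕ → Prop} :
    WP (.write a e₁ e₂) M Q ↔
      Q (M.setArr a (Function.update (M.arr a) (e₁.eval M) (e₂.eval M)))
        (e₁.cost + e₂.cost + 1) := by
  constructor
  · rintro ⟨_, _, h, hQ⟩
    cases h
    exact hQ
  · exact fun h => ⟨_, _, .write a e₁ e₂ M, h⟩

@[simp] theorem wp_seq {c₁ c₂ : Prog} {M : Memory} {Q : Memory → ℕ → Prop} :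
    WP (.seq c₁ c₂) M Q ↔ WP c₁ M fun M₁ t₁ => WP c₂ M₁ fun M₂ t₂ => Q M₂ (t₁ + t₂) := by
  constructor
  · rintro ⟨_, _, h, hQ⟩
    cases h with
    | seq h₁ h₂ => exact ⟨_, _, h₁, _, _, h₂, hQ⟩
  · rintro ⟨_, _, h₁, _, _, h₂, hQ⟩
    exact ⟨_, _, h₁.seq h₂, hQ⟩

@[simp] theorem wp_ite {e₁ e₂ : Expr} {c₁ c₂ : Prog} {M : Memory} {Q : Memory → ℕ → Prop} :
    WP (.ite e₁ e₂ c₁ c₂) M Q ↔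
      if e₁.eval M < e₂.eval M
      then WP c₁ M fun M' t => Q M' (e₁.cost + e₂.cost + 1 + t)
      else WP c₂ M fun M' t => Q M' (e₁.cost + e₂.cost + 1 + t) := by
  constructor
  · rintro ⟨_, _, h, hQ⟩
    cases h with
    | iteTrue h h' => rw [if_pos h]; exact ⟨_, _, h', hQ⟩
    | iteFalse h h' => rw [if_neg h]; exact ⟨_, _, h', hQ⟩
  · split_ifs with h
    · rintro ⟨_, _, h', hQ⟩
      exact ⟨_, _, .iteTrue h h', hQ⟩
    · rintro ⟨_, _, h', hQ⟩
      exact ⟨_, _, .iteFalse h h', hQ⟩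

/-- Total correctness with a cost: `K` is the exact number of iterations and `T k` bounds the cost
of the first `k` of them, tests included. The last, failing test is added in `post`. -/
theorem wp_while {e₁ e₂ : Expr} {c : Prog} {M₀ : Memory} {Q : Memory → ℕ → Prop}
    (K : ℕ) (I : ℕ → Memory → Prop) (T : ℕ → ℕ) (h0 : I 0 M₀)
    (step : ∀ k < K, ∀ M, Same c M₀ M → I k M → e₁.eval M < e₂.eval M ∧
      WP c M fun M' t => I (k + 1) M' ∧ T k + (e₁.cost + e₂.cost + 1) + t ≤ T (k + 1))
    (done : ∀ M, Same c M₀ M → I K M → ¬ e₁.eval M < e₂.eval M)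
    (post : ∀ M t, Same c M₀ M → I K M → t ≤ T K + (e₁.cost + e₂.cost + 1) → Q M t) :
    WP (.while e₁ e₂ c) M₀ Q := by
  -- Induction on the number `j` of iterations still to come. The cost is stated additively, to
  -- avoid truncated subtraction.
  suffices h : ∀ j k, k + j = K → ∀ M, Same c M₀ M → I k M →
      WP (.while e₁ e₂ c) M fun M' t =>
        Same c M₀ M' ∧ I K M' ∧ t + T k ≤ T K + (e₁.cost + e₂.cost + 1) by
    refine (h K 0 (zero_add K) M₀ (.refl _ _) h0).mono ?_
    rintro M t - ⟨hs, hI, ht⟩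
    exact post M t hs hI (by omega)
  intro j
  induction j with
  | zero =>
    intro k hk M hs hI
    obtain rfl : k = K := by omega
    exact ⟨M, _, .whileDone (done M hs hI), hs, hI, by omega⟩
  | succ j ih =>
    intro k hk M hs hI
    obtain ⟨hlt, M₁, t₁, hr, hI₁, ht₁⟩ := step k (by omega) M hs hI
    obtain ⟨M₂, t₂, hr₂, hs₂, hI₂, ht₂⟩ := ih (k + 1) (by omega) M₁ (hs.trans hr.same) hI₁
    exact ⟨M₂, _, .whileStep hlt hr hr₂, hs₂, hI₂, by omega⟩

/-- The sequential composition of the programs in a list. -/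
def Prog.block : List Prog → Prog
  | [] => .skip
  | [c] => c
  | c :: c' :: l => .seq c (block (c' :: l))

@[simp] theorem wp_block_one {c : Prog} {M : Memory} {Q : Memory → ℕ → Prop} :
    WP (.block [c]) M Q ↔ WP c M Q := Iff.rfl

@[simp] theorem wp_block_cons {c c' : Prog} {l : List Prog} {M : Memory}
    {Q : Memory → ℕ → Prop} :
    WP (.block (c :: c' :: l)) M Q ↔
      WP c M fun M₁ t₁ => WP (.block (c' :: l)) M₁ fun M₂ t₂ => Q M₂ (t₁ + t₂) :=
  wp_seq

/-- The counting loop `for i = 0, …, b - 1 do c`, where `i` and `b` are registers. -/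
def Prog.loop (i b : ℕ) (c : Prog) : Prog :=
  .seq (.assign i (.const 0))
    (.while (.reg i) (.reg b) (.seq c (.assign i (.add (.reg i) (.const 1)))))

/-- The 7 is the test (3) plus the increment (4); the 5 is the initial assignment (2) plus the
failing test (3). The last two hypotheses say that the body changes neither the counter nor the
bound. -/
theorem wp_loop {i b : ℕ} {c : Prog} {M₀ : Memory} {Q : Memory → ℕ → Prop}
    (K : ℕ) (I : ℕ → Memory → Prop) (T : ℕ → ℕ) (hK : M₀.reg b = K)
    (h0 : I 0 (M₀.setReg i 0))
    (step : ∀ k < K, ∀ M, Same (.loop i b c) M₀ M → M.reg i = k → I k M →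
      WP c M fun M' t => I (k + 1) (M'.setReg i ((k + 1 : ℕ) : ℤ)) ∧ T k + t + 7 ≤ T (k + 1))
    (post : ∀ M t, Same (.loop i b c) M₀ M → I K M → t ≤ T K + 5 → Q M t)
    (hi : i ∉ c.regs := by decide) (hb : b ∉ i :: c.regs := by decide) :
    WP (.loop i b c) M₀ Q := by
  have hsub : ∀ M, Same (.seq c (.assign i (.add (.reg i) (.const 1)))) (M₀.setReg i 0) M →
      Same (.loop i b c) M₀ M := by
    intro M hs
    constructor
    · intro x hx
      simp only [Prog.loop, Prog.regs, List.mem_append, List.mem_cons, List.not_mem_nil,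
        not_or] at hx
      rw [hs.reg x (by simp [Prog.regs, hx])]
      simp [hx]
    · intro x hx
      simp only [Prog.loop, Prog.arrs, List.mem_append, List.not_mem_nil, or_false,
        not_or] at hx
      rw [hs.arr x (by simp [Prog.arrs, hx])]
      simp
  have hbM : ∀ M, Same (.loop i b c) M₀ M → M.reg b = K := by
    intro M hs
    rw [hs.reg b (by simp [Prog.loop, Prog.regs] at hb ⊢; tauto), hK]
  rw [Prog.loop, wp_seq, wp_assign]
  refine wp_while K (fun k M => M.reg i = k ∧ I k M) T ⟨by simp [Expr.eval], h0⟩ ?_ ?_ ?_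
  · rintro k hk M hs ⟨hik, hI⟩
    refine ⟨by simpa [Expr.eval, hik, hbM M (hsub M hs)] using hk, ?_⟩
    rw [wp_seq]
    refine (step k hk M (hsub M hs) hik hI).mono ?_
    rintro M' t hs' ⟨hI', ht⟩
    have : M'.reg i = k := by rw [hs'.reg i hi, hik]
    simp only [wp_assign, Expr.eval, this, Expr.cost]
    refine ⟨⟨by simp, by simpa using hI'⟩, by omega⟩
  · rintro M hs ⟨hik, hI⟩
    simp [Expr.eval, hik, hbM M (hsub M hs)]
  · rintro M t hs ⟨-, hI⟩ ht
    exact post M _ (hsub M hs) hI (by simp only [Expr.cost] at ht ⊢; omega)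

attribute [simp] Expr.eval Expr.cost

section

/-! ### Mixed-radix tables -/

/-- The linear function of the base `N` digits of a number, with the given coefficients. -/
def lin (N : ℕ) : List ℤ → ℕ → ℤ
  | [], _ => 0
  | a :: as, q => a * (q % N : ℕ) + lin N as (q / N)

/-- The number whose base `N` digits are the values of `d` on the list. -/
def enc {V : Type*} (N : ℕ) (d : V → ℕ) : List V → ℕ
  | [] => 0
  | v :: L => d v + N * enc N d L

theorem enc_lt {V : Type*} {N : ℕ} {d : V → ℕ} (hd : ∀ v, d v < N) (L : List V) :
    enc N d L < N ^ L.length := by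
  induction L with
  | nil => simp [enc]
  | cons v L ih =>
    simp only [enc, List.length_cons, pow_succ]
    have := hd v
    nlinarith

theorem enc_congr {V : Type*} {N : ℕ} {d d' : V → ℕ} {L : List V} (h : ∀ v ∈ L, d v = d' v) :
    enc N d L = enc N d' L := by
  induction L with
  | nil => rfl
  | cons v L ih =>
    simp only [enc]
    rw [h v (by simp), ih fun u hu => h u (by simp [hu])]

theorem lin_enc {V : Type*} {N : ℕ} {d : V → ℕ} (hd : ∀ v, d v < N) (a : V → ℤ) (L : List V) :
    lin N (L.map a) (enc N d L) = (L.map fun v => a v * d v).sum := by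
  induction L with
  | nil => rfl
  | cons v L ih =>
    have hv := hd v
    have h1 : (d v + N * enc N d L) % N = d v := by
      rw [Nat.add_mul_mod_self_left, Nat.mod_eq_of_lt hv]
    have h2 : (d v + N * enc N d L) / N = enc N d L := by
      rw [Nat.add_mul_div_left _ _ (by omega), Nat.div_eq_of_lt hv, zero_add]
    simp only [enc, List.map_cons, lin, List.sum_cons, h1, h2, ih]

theorem lin_append_of_lt {N : ℕ} (as : List ℤ) (a : ℤ) {q : ℕ} (hq : q < N ^ as.length) :
    lin N (as ++ [a]) q = lin N as q := by
  induction as generalizing q with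
  | nil =>
    obtain rfl : q = 0 := by simpa using hq
    simp [lin]
  | cons b as ih =>
    simp only [List.cons_append, lin]
    rw [ih]
    rw [List.length_cons, pow_succ] at hq
    exact Nat.div_lt_of_lt_mul (by rwa [mul_comm])

/-- Adding N ^ k raises digit `k` by one and leaves the lower digits alone; the hypothesis says that
this digit does not overflow. This is the recursion by which tables are filled. -/
theorem lin_append_add {N : ℕ} (as : List ℤ) (a : ℤ) {q : ℕ}
    (hq : q + N ^ as.length < N ^ (as.length + 1)) :
    lin N (as ++ [a]) (N ^ as.length + q) = lin N (as ++ [a]) q + a := by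
  induction as generalizing q with
  | nil =>
    simp only [List.length_nil, pow_zero, zero_add, pow_one] at hq
    simp only [List.nil_append, lin, List.length_nil, pow_zero, add_zero]
    rw [Nat.mod_eq_of_lt (by omega), Nat.mod_eq_of_lt (by omega)]
    push_cast
    ring
  | cons b as ih =>
    have hN : 0 < N := by
      rcases Nat.eq_zero_or_pos N with rfl | h
      · simp at hq
      · exact h
    simp only [List.cons_append, lin, List.length_cons]
    rw [pow_succ, Nat.mul_add_mod_self_right, add_comm (_ * N), Nat.add_mul_div_right _ _ hN,
      add_comm (q / N), ih]
    · ring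
    · have : q + N ^ as.length * N < N ^ (as.length + 1) * N := by
        simpa [pow_succ] using hq
      rw [← Nat.add_mul_div_right _ _ hN]
      exact Nat.div_lt_of_lt_mul (by
        rwa [mul_comm N (N ^ (as.length + 1))])

/-- An address in a message is itself a linear function of the digits, so it can be tabulated like a
row of the matrix. -/
theorem sum_map_idxOf {V : Type*} [DecidableEq V] {N : ℕ} {d : V → ℕ} {L : List V}
    (hL : L.Nodup) :
    (L.map fun v => N ^ L.idxOf v * d v).sum = enc N d L := by
  induction L with
  | nil => rfl
  | cons v L ih =>
    rw [List.nodup_cons] at hL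
    simp only [List.map_cons, List.sum_cons, List.idxOf_cons_self, pow_zero, one_mul, enc]
    rw [← ih hL.2, ← List.sum_map_mul_left]
    congr 2
    refine List.map_congr_left fun u hu => ?_
    rw [List.idxOf_cons_ne _ (by rintro rfl; exact hL.1 hu), pow_succ]
    ring

/-! ### The bags of an elimination ordering -/

variable {n : ℕ}

/-- The list of the vertices of the bag with number `l`; bag number `n` is empty. -/
noncomputable def bag (H : SimpleGraph (Fin n)) (σ : Equiv.Perm (Fin n)) (l : ℕ) :
    List (Fin n) :=
  if h : l < n then elimList H σ ⟨l, h⟩ else []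

/-- The start address of the list of bag number `l`. -/
noncomputable def bagStart (H : SimpleGraph (Fin n)) (σ : Equiv.Perm (Fin n)) (l : ℕ) : ℕ :=
  ∑ k ∈ Finset.range l, (bag H σ k).length

/-- The start address of the table of bag number `l`. -/
noncomputable def tableStart (N : ℕ) (H : SimpleGraph (Fin n)) (σ : Equiv.Perm (Fin n)) (l : ℕ) :
    ℕ :=
  ∑ k ∈ Finset.range l, N ^ (bag H σ k).length

variable {H : SimpleGraph (Fin n)} {σ : Equiv.Perm (Fin n)}

theorem bag_of_le {l : ℕ} (hl : n ≤ l) : bag H σ l = [] := dif_neg (by omega)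

theorem mem_bag {l : ℕ} {v : Fin n} :
    v ∈ bag H σ l ↔ ∃ h : l < n, σ.symm v = ⟨l, h⟩ ∨
      (⟨l, h⟩ < σ.symm v ∧ H.Adj (σ ⟨l, h⟩) v) := by
  unfold bag
  split_ifs with h
  · simp only [elimList, List.mem_map, List.mem_filter, List.mem_finRange, true_and,
      decide_eq_true_eq, h, exists_true_left]
    constructor
    · rintro ⟨k, hk, rfl⟩
      simpa using hk
    · intro hv
      exact ⟨σ.symm v, by simpa using hv, by simp⟩
  · simp [h]

theorem nodup_bag (l : ℕ) : (bag H σ l).Nodup := by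
  unfold bag
  split_ifs with h
  · exact ((List.nodup_finRange n).filter _).map σ.injective
  · exact List.nodup_nil

theorem length_bag_le (l : ℕ) : (bag H σ l).length ≤ n := by
  simpa using (nodup_bag (H := H) (σ := σ) l).length_le_card

theorem sorted_bag (l : ℕ) : ((bag H σ l).map σ.symm).Pairwise (· < ·) := by
  unfold bag
  split_ifs with h
  · simp only [elimList, List.map_map, Equiv.symm_comp_self, List.map_id]
    exact (List.pairwise_lt_finRange n).filter _
  · simp

/-- All other members come later in the ordering and the list is sorted. The eliminated variable is
thus the least significant digit, and its values occupy `N` consecutive table entries. -/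
theorem bag_eq_cons {l : ℕ} (hl : l < n) : bag H σ l = σ ⟨l, hl⟩ :: (bag H σ l).tail := by
  have hs := sorted_bag (H := H) (σ := σ) l
  have hm : σ ⟨l, hl⟩ ∈ bag H σ l := mem_bag.2 ⟨hl, by simp⟩
  rcases hb : bag H σ l with _ | ⟨v, L⟩
  · simp [hb] at hm
  · simp only [List.tail_cons, List.cons.injEq, and_true]
    rw [hb] at hm hs
    rcases List.mem_cons.1 hm with h | h
    · exact h.symm
    · exfalso
      simp only [List.map_cons, List.pairwise_cons, List.mem_map] at hs
      have h1 := hs.1 (σ.symm (σ ⟨l, hl⟩)) ⟨_, h, rfl⟩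
      have hv : v ∈ bag H σ l := by simp [hb]
      obtain ⟨_, h2 | h2⟩ := mem_bag.1 hv
      · rw [h2] at h1
        simp at h1
      · have := h2.1.trans h1
        simp at this

theorem not_mem_bag {l l' : ℕ} (hl : l < n) (h : l < l') : σ ⟨l, hl⟩ ∉ bag H σ l' := by
  intro hm
  obtain ⟨h', h2 | h2⟩ := mem_bag.1 hm
  · simp at h2
    omega
  · have := h2.1
    simp at this
    omega

/-- The bag number that receives the message of bag number `l`. -/
noncomputable def parent (H : SimpleGraph (Fin n)) (σ : Equiv.Perm (Fin n)) (l : ℕ) : ℕ :=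
  match (bag H σ l).tail with
  | [] => n
  | v :: _ => σ.symm v

theorem parent_le (l : ℕ) : parent H σ l ≤ n := by
  unfold parent
  split
  · exact le_rfl
  · exact (Fin.is_lt _).le

theorem lt_parent {l : ℕ} (hl : l < n) : l < parent H σ l := by
  unfold parent
  split
  · exact hl
  · next v L h =>
    have hs := sorted_bag (H := H) (σ := σ) l
    rw [bag_eq_cons hl, h] at hs
    simp only [List.map_cons, List.pairwise_cons, List.mem_cons] at hs
    have := hs.1 _ (Or.inl rfl)
    simpa [Fin.lt_def] using this

/-- Here perfect elimination enters: the tail is part of a clique, so its members other than the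
first are neighbours of the first that come later, which makes them members of its bag. -/
theorem tail_subset_parent (hP : IsPerfectElimination H σ) {l : ℕ} (hl : l < n) {v : Fin n}
    (hv : v ∈ (bag H σ l).tail) : v ∈ bag H σ (parent H σ l) := by
  unfold parent
  rcases h : (bag H σ l).tail with _ | ⟨u, L⟩
  · simp [h] at hv
  rw [mem_bag]
  refine ⟨Fin.is_lt _, ?_⟩
  simp only [Fin.eta, Equiv.apply_symm_apply]
  by_cases huv : v = u
  · exact Or.inl (by rw [huv])
  right
  have hs := sorted_bag (H := H) (σ := σ) l
  have hb := bag_eq_cons (H := H) (σ := σ) hl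
  have hmem : ∀ w ∈ (bag H σ l).tail, w ∈ elimSet H σ ⟨l, hl⟩ := by
    intro w hw
    obtain ⟨_, hw⟩ := mem_bag.1 (List.mem_of_mem_tail hw)
    refine ⟨σ.symm w, by simp, by simpa using hw⟩
  rw [hb, h] at hs
  simp only [List.map_cons, List.pairwise_cons, List.mem_map] at hs
  refine ⟨hs.2.1 _ ⟨v, ?_, rfl⟩, ?_⟩
  · rw [h] at hv
    simpa [huv] using hv
  · exact hP ⟨l, hl⟩ (hmem u (by simp [h])) (hmem v hv) (Ne.symm huv)

theorem length_bag_le_cliqueNum (hP : IsPerfectElimination H σ) (l : ℕ) :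
    (bag H σ l).length ≤ H.cliqueNum := by
  classical
  by_cases hl : l < n
  · rw [← List.toFinset_card_of_nodup (nodup_bag l)]
    refine SimpleGraph.IsClique.card_le_cliqueNum (tc := ?_)
    intro v hv u hu
    have hmem : ∀ w ∈ bag H σ l, w ∈ elimSet H σ ⟨l, hl⟩ := by
      intro w hw
      obtain ⟨_, hw⟩ := mem_bag.1 hw
      refine ⟨σ.symm w, by simp, by simpa using hw⟩
    exact hP ⟨l, hl⟩ (hmem v (by simpa using hv)) (hmem u (by simpa using hu))
  · simp [bag_of_le (not_lt.1 hl)]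

theorem tableStart_succ (N l : ℕ) :
    tableStart N H σ (l + 1) = tableStart N H σ l + N ^ (bag H σ l).length :=
  Finset.sum_range_succ _ _

theorem tableStart_mono (N : ℕ) : Monotone (tableStart N H σ) :=
  monotone_nat_of_le_succ fun l => by rw [tableStart_succ]; omega

theorem tableStart_add_le {N l l' : ℕ} (h : l < l') :
    tableStart N H σ l + N ^ (bag H σ l).length ≤ tableStart N H σ l' := by
  rw [← tableStart_succ]
  exact tableStart_mono N h

/-- The tables occupy disjoint intervals of addresses. -/
theorem tableStart_add_mem {N l l' q : ℕ} (hq : q < N ^ (bag H σ l).length) :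
    (tableStart N H σ l' ≤ tableStart N H σ l + q ∧
      tableStart N H σ l + q < tableStart N H σ l' + N ^ (bag H σ l').length) ↔ l = l' := by
  constructor
  · rintro ⟨h1, h2⟩
    rcases lt_trichotomy l l' with h | h | h
    · have := tableStart_add_le (N := N) (H := H) (σ := σ) h
      omega
    · exact h
    · have := tableStart_add_le (N := N) (H := H) (σ := σ) h
      omega
  · rintro rfl
    omega

theorem bagStart_succ (l : ℕ) : bagStart H σ (l + 1) = bagStart H σ l + (bag H σ l).length :=
  Finset.sum_range_succ _ _

end

section

/-! ### Subprograms

Besides the input, registers `4, 5` hold the radix `N = 2 g + 1` and the penalty `n g + 1`, and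
arrays `7` to `10` hold the powers of `N`, the inverse of the ordering, the lengths of the bags,
and the start addresses of their tables. The scratch arrays are: `16`, the tables of penalties for the
violated rows; `17`, the coefficients of a linear function; `18`, its table; `19`, the tables of the
dynamic program; `20`, a message; `21`, the weights of the values of a variable. -/

/-- The memory holds the data that the subprograms only read. -/
structure Env {n : ℕ} (g N : ℕ) (H : SimpleGraph (Fin n)) (σ : Equiv.Perm (Fin n))
    (M : Memory) : Prop where
  dim : M.reg 0 = n
  bound : M.reg 2 = g
  radix : M.reg 4 = N
  penalty : M.reg 5 = n * g + 1
  order : ∀ l (hl : l < n), M.arr 3 l = (σ ⟨l, hl⟩ : ℕ)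
  start : ∀ l ≤ n, M.arr 4 l = bagStart H σ l
  vertex : ∀ l k (hk : k < (bag H σ l).length),
    M.arr 5 (bagStart H σ l + k) = ((bag H σ l)[k] : ℕ)
  pow : ∀ k ≤ n, M.arr 7 k = N ^ k
  position : ∀ v : Fin n, M.arr 8 v = (σ.symm v : ℕ)
  length : ∀ l ≤ n, M.arr 9 l = (bag H σ l).length
  table : ∀ l ≤ n, M.arr 10 l = tableStart N H σ l

/-- The program may only write to registers and arrays with numbers `≥ 16`. -/
def Prog.High (c : Prog) : Prop := (∀ x ∈ c.regs, 16 ≤ x) ∧ ∀ a ∈ c.arrs, 16 ≤ a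

instance (c : Prog) : Decidable c.High := inferInstanceAs (Decidable (_ ∧ _))

/-- The memories agree on the registers and arrays with numbers `< 16`. -/
def Low (M M' : Memory) : Prop := (∀ x < 16, M'.reg x = M.reg x) ∧ ∀ a < 16, M'.arr a = M.arr a

theorem Low.trans {M M' M'' : Memory} (h : Low M M') (h' : Low M' M'') : Low M M'' :=
  ⟨fun x hx => (h'.1 x hx).trans (h.1 x hx), fun x hx => (h'.2 x hx).trans (h.2 x hx)⟩

theorem Same.low {c : Prog} {M M' : Memory} (h : Same c M M') (hc : c.High := by decide) :
    Low M M' :=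
  ⟨fun x hx => h.reg x fun hm => by have := hc.1 x hm; omega,
    fun x hx => h.arr x fun hm => by have := hc.2 x hm; omega⟩

theorem Low.setReg {M M' : Memory} (h : Low M M') {x : ℕ} (hx : 16 ≤ x) (v : ℤ) :
    Low M (M'.setReg x v) :=
  ⟨fun y hy => by rw [reg_setReg, if_neg (by omega), h.1 y hy], h.2⟩

theorem Low.setArr {M M' : Memory} (h : Low M M') {x : ℕ} (hx : 16 ≤ x) (f : ℤ → ℤ) :
    Low M (M'.setArr x f) :=
  ⟨h.1, fun y hy => by rw [arr_setArr, if_neg (by omega), h.2 y hy]⟩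

theorem Low.refl (M : Memory) : Low M M := ⟨fun _ _ => rfl, fun _ _ => rfl⟩

variable {n g N : ℕ} {H : SimpleGraph (Fin n)} {σ : Equiv.Perm (Fin n)}

theorem Env.of_low {M M' : Memory} (h : Env g N H σ M) (hM : Low M M') : Env g N H σ M' := by
  constructor
  · rw [hM.1 0 (by norm_num), h.dim]
  · rw [hM.1 2 (by norm_num), h.bound]
  · rw [hM.1 4 (by norm_num), h.radix]
  · rw [hM.1 5 (by norm_num), h.penalty]
  · rw [hM.2 3 (by norm_num)]; exact h.order
  · rw [hM.2 4 (by norm_num)]; exact h.start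
  · rw [hM.2 5 (by norm_num)]; exact h.vertex
  · rw [hM.2 7 (by norm_num)]; exact h.pow
  · rw [hM.2 8 (by norm_num)]; exact h.position
  · rw [hM.2 9 (by norm_num)]; exact h.length
  · rw [hM.2 10 (by norm_num)]; exact h.table

/-- Array `18` becomes the table of the linear function of the variables of the bag with number
`reg 16` whose coefficients are in array `17`; the entry at `0` is not changed. -/
def fill : Prog := .block [
  .assign 17 (.read 4 (.reg 16)),
  .assign 18 (.read 9 (.reg 16)),
  .loop 19 18 (.block [
    .assign 20 (.read 17 (.read 5 (.add (.reg 17) (.reg 19)))),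
    .assign 21 (.read 7 (.reg 19)),
    .assign 22 (.sub (.read 7 (.add (.reg 19) (.const 1))) (.reg 21)),
    .loop 23 22 (.write 18 (.add (.reg 21) (.reg 23)) (.add (.read 18 (.reg 23)) (.reg 20)))])]

/-- After `k` rounds the first N ^ k entries are final. Round `k` appends N ^ (k + 1) - N ^ k
entries, so the cost telescopes to the size of the table instead of gaining a factor for the number
of digits. -/
theorem wp_fill {M : Memory} (hE : Env g N H σ M) (hN : 0 < N) {p : ℕ} (hp : p ≤ n)
    (hreg : M.reg 16 = p) {a : Fin n → ℤ} (ha : ∀ v : Fin n, M.arr 17 v = a v) {t₀ : ℤ}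
    (ht₀ : M.arr 18 0 = t₀) :
    WP fill M fun M' t =>
      (∀ q < N ^ (bag H σ p).length, M'.arr 18 q = t₀ + lin N ((bag H σ p).map a) q) ∧
      t ≤ 20 + 40 * (bag H σ p).length + 20 * N ^ (bag H σ p).length := by
  have hlen := length_bag_le (H := H) (σ := σ) p
  simp only [fill, wp_block_cons, wp_block_one, wp_assign, Expr.eval, reg_setReg, hreg,
    arr_setReg, hE.start p hp, hE.length p hp, Expr.cost, Nat.reduceEqDiff, ↓reduceIte]
  refine wp_loop (bag H σ p).length
    (fun k M => ∀ q < N ^ k, M.arr 18 q = t₀ + lin N (((bag H σ p).take k).map a) q)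
    (fun k => 40 * k + 20 * N ^ k) (by simp) ?_ ?_ ?_
  · intro q hq
    obtain rfl : q = 0 := by simpa using hq
    simp [lin, ht₀]
  · intro k hk M₁ hs hik hI
    have hlow : Low M M₁ :=
      (((Low.refl M).setReg (by norm_num) _).setReg (by norm_num) _).trans (hs.low)
    have hE₁ := hE.of_low hlow
    have h17 : M₁.reg 17 = bagStart H σ p := by
      rw [hs.reg 17 (by decide)]; simp
    have hc : M₁.arr 17 = M.arr 17 := by
      rw [hs.arr 17 (by decide)]; simp
    have hle : N ^ k ≤ N ^ (k + 1) := Nat.pow_le_pow_right hN (by omega)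
    have hpow := hE₁.pow (k + 1) (by omega)
    push_cast at hpow
    simp only [wp_block_cons, wp_block_one, wp_assign, Expr.eval, reg_setReg, hik, h17, hc,
      arr_setReg, hE₁.vertex p k hk, hE₁.pow k (by omega), hpow, ha, Expr.cost,
      Nat.reduceEqDiff, ↓reduceIte]
    -- Entry N ^ k + j is entry j plus the new coefficient; as j < N ^ k + j, entry j is already
    -- final, even when it was written in this same round.
    refine wp_loop (N ^ (k + 1) - N ^ k)
      (fun j M => ∀ q < N ^ k + j,
        M.arr 18 q = t₀ + lin N (((bag H σ p).take (k + 1)).map a) q)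
      (fun j => 15 * j) (by simp [Nat.cast_sub hle]) ?_ ?_ ?_
    · intro q hq
      simp only [arr_setReg]
      rw [hI q hq, List.take_succ_eq_append_getElem hk, List.map_append, List.map_singleton,
        lin_append_of_lt]
      simpa [min_eq_left hk.le] using hq
    · intro j hj M₂ hs₂ hij hI₂
      have h21 : M₂.reg 21 = (N ^ k : ℕ) := by
        rw [hs₂.reg 21 (by decide)]; simp
      have h20 : M₂.reg 20 = a (bag H σ p)[k] := by
        rw [hs₂.reg 20 (by decide)]; simp
      simp only [wp_write, Expr.eval, h20, h21, hij, Expr.cost]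
      refine ⟨fun q hq => ?_, by omega⟩
      simp only [arr_setReg, arr_setArr, if_true, Function.update_apply]
      have h1 : (q : ℤ) = (N ^ k : ℕ) + (j : ℤ) ↔ q = N ^ k + j := by
        rw [← Nat.cast_add, Nat.cast_inj]
      split_ifs with h
      · rw [h1] at h
        subst h
        have hN1 : 0 < N ^ k := Nat.pow_pos hN
        rw [hI₂ j (by omega), List.take_succ_eq_append_getElem hk, List.map_append,
          List.map_singleton]
        have := lin_append_add (N := N) (((bag H σ p).take k).map a) (a (bag H σ p)[k]) (q := j)
        simp only [List.length_map, List.length_take, min_eq_left hk.le] at this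
        rw [this (by omega)]
        ring
      · exact hI₂ q (by omega)
    · intro M₂ t hs₂ hI₂ ht
      refine ⟨fun q hq => ?_, ?_⟩
      · exact hI₂ q (by omega)
      · omega
  · intro M₁ t hs hI ht
    refine ⟨?_, by omega⟩
    simpa using hI

/-- Set the entries of array `17` at the `reg 25` addresses that array `src` holds from address
`reg 24` on to `0`. -/
def clear (src : ℕ) : Prog :=
  .loop 26 25 (.write 17 (.read src (.add (.reg 24) (.reg 26))) (.const 0))

/-- Resetting only the touched entries costs the length of the list and not `n`, so one coefficient
array serves all rows and all messages. -/
theorem wp_clear {src : ℕ} (hsrc : src ≠ 17) {M : Memory} {s : ℤ} {L : List (Fin n)}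
    (hs : M.reg 24 = s) (hcnt : M.reg 25 = L.length)
    (hL : ∀ k (hk : k < L.length), M.arr src (s + k) = (L[k] : ℕ))
    (h0 : ∀ v : Fin n, v ∉ L → M.arr 17 v = 0) :
    WP (clear src) M fun M' t =>
      (∀ v : Fin n, M'.arr 17 v = 0) ∧ t ≤ 20 * L.length + 5 := by
  refine wp_loop L.length
    (fun k M => ∀ v : Fin n, (v ∈ L.take k ∨ v ∉ L) → M.arr 17 v = 0)
    (fun k => 20 * k) hcnt ?_ ?_ ?_ (by simp [Prog.regs]) (by simp [Prog.regs])
  · simpa using h0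
  · intro k hk M₁ hs₁ hik hI
    have h24 : M₁.reg 24 = s := by rw [hs₁.reg 24 (by simp [Prog.loop, Prog.regs]), hs]
    have harr : M₁.arr src = M.arr src :=
      hs₁.arr src (by simp [Prog.loop, Prog.arrs, hsrc])
    simp only [wp_write, Expr.eval, h24, hik, harr, hL k hk, Expr.cost]
    refine ⟨fun v hv => ?_, by omega⟩
    simp only [arr_setReg, arr_setArr, if_true, Function.update_apply, Nat.cast_inj, Fin.val_inj]
    split_ifs with h
    · rfl
    · apply hI
      rw [List.take_succ_eq_append_getElem hk, List.mem_append, List.mem_singleton] at hv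
      tauto
  · intro M₁ t hs₁ hI ht
    refine ⟨fun v => hI v ?_, by omega⟩
    simpa using em (v ∈ L)

end

/-! ### Weights of a variable, and the messages between bags -/

section

variable {n g N : ℕ} {H : SimpleGraph (Fin n)} {σ : Equiv.Perm (Fin n)}

/-- The weight of the value `i - g` of the variable `v`: its absolute value if it is conformal
to `z v`, and a penalty otherwise. The value `z J` of the variable `J` is penalized, too. -/
def weight (g : ℕ) (z : Fin n → ℤ) (J : ℤ) (v : Fin n) (i : ℕ) : ℤ :=
  if ((0 ≤ (i : ℤ) - g ∧ (i : ℤ) - g ≤ z v) ∨ (z v ≤ (i : ℤ) - g ∧ (i : ℤ) - g ≤ 0)) ∧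
    ¬ ((i : ℤ) - g = z v ∧ ((v : ℕ) : ℤ) = J) then |(i : ℤ) - g| else -(n * g + 1)

/-- Replace `reg 36` by the absolute value of `reg 35` if `reg 35` is conformal to `reg 33`. -/
def conform : Prog :=
  .ite (.reg 35) (.const 0)
    (.ite (.reg 35) (.reg 33) .skip (.assign 36 (.sub (.const 0) (.reg 35))))
    (.ite (.reg 33) (.reg 35)
      (.ite (.const 0) (.reg 35) .skip (.assign 36 (.reg 35)))
      (.assign 36 (.reg 35)))

theorem wp_conform {M : Memory} {x z : ℤ} (hx : M.reg 35 = x) (hz : M.reg 33 = z) :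
    WP conform M fun M' t =>
      M'.reg 36 = (if (0 ≤ x ∧ x ≤ z) ∨ (z ≤ x ∧ x ≤ 0) then |x| else M.reg 36) ∧ t ≤ 20 := by
  simp only [conform, wp_ite, wp_assign, wp_skip, Expr.eval, hx, hz, Expr.cost, reg_setReg,
    ↓reduceIte]
  rcases abs_cases x with ⟨h, h'⟩ | ⟨h, h'⟩ <;> rw [h] <;> split_ifs <;>
    refine ⟨?_, by omega⟩ <;> omega

/-- Replace `reg 36` by `-reg 5` if `reg 35` equals `reg 33` and `reg 32` equals `reg 30`. -/
def exclude : Prog :=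
  .ite (.reg 35) (.reg 33) .skip (.ite (.reg 33) (.reg 35) .skip
    (.ite (.reg 32) (.reg 30) .skip (.ite (.reg 30) (.reg 32) .skip
      (.assign 36 (.sub (.const 0) (.reg 5))))))

theorem wp_exclude {M : Memory} {x z v J b : ℤ} (hx : M.reg 35 = x) (hz : M.reg 33 = z)
    (hv : M.reg 32 = v) (hJ : M.reg 30 = J) (hb : M.reg 5 = b) :
    WP exclude M fun M' t =>
      M'.reg 36 = (if x = z ∧ v = J then -b else M.reg 36) ∧ t ≤ 20 := by
  simp only [exclude, wp_ite, wp_assign, wp_skip, Expr.eval, hx, hz, hv, hJ, hb, Expr.cost,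
    reg_setReg, ↓reduceIte]
  split_ifs <;> refine ⟨?_, by omega⟩ <;> omega

/-- Array `21` becomes the table of the weights of the vertex with number `reg 31` in the
elimination ordering. -/
def domain : Prog := .block [
  .assign 32 (.read 3 (.reg 31)),
  .assign 33 (.read 6 (.reg 32)),
  .loop 34 4 (.block [
    .assign 35 (.sub (.reg 34) (.reg 2)),
    .assign 36 (.sub (.const 0) (.reg 5)),
    conform,
    exclude,
    .write 21 (.reg 34) (.reg 36)])]

theorem wp_domain {M : Memory} (hE : Env g N H σ M) {z : Fin n → ℤ}
    (hz : ∀ v : Fin n, M.arr 6 v = z v) {J : ℤ} (hJ : M.reg 30 = J) {c : ℕ} (hc : c < n)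
    (hreg : M.reg 31 = c) :
    WP domain M fun M' t =>
      (∀ i < N, M'.arr 21 i = weight g z J (σ ⟨c, hc⟩) i) ∧ t ≤ 20 + 100 * N := by
  simp only [domain, wp_block_cons, wp_block_one, wp_assign, Expr.eval, reg_setReg, hreg,
    arr_setReg, hE.order c hc, Expr.cost, ↓reduceIte, hz]
  refine wp_loop N (fun k M => ∀ i < k, M.arr 21 i = weight g z J (σ ⟨c, hc⟩) i)
    (fun k => 100 * k) (by simp [hE.radix]) (by simp) ?_ ?_
  · intro k hk M₁ hs hik hI
    have h32 : M₁.reg 32 = (σ ⟨c, hc⟩ : ℕ) := by rw [hs.reg 32 (by decide)]; simp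
    have h33 : M₁.reg 33 = z (σ ⟨c, hc⟩) := by rw [hs.reg 33 (by decide)]; simp
    have h30 : M₁.reg 30 = J := by rw [hs.reg 30 (by decide)]; simp [hJ]
    have h2 : M₁.reg 2 = g := by rw [hs.reg 2 (by decide)]; simp [hE.bound]
    have h5 : M₁.reg 5 = n * g + 1 := by rw [hs.reg 5 (by decide)]; simp [hE.penalty]
    simp only [wp_block_cons, wp_block_one, wp_assign, Expr.eval, reg_setReg, Expr.cost,
      Nat.reduceEqDiff, ↓reduceIte, hik, h2, h5]
    refine (wp_conform (x := k - g) (z := z (σ ⟨c, hc⟩)) (by simp) (by simp [h33])).mono ?_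
    rintro M₂ t₂ hs₂ ⟨h36, ht₂⟩
    refine (wp_exclude (M := M₂) (x := k - g) (z := z (σ ⟨c, hc⟩)) (v := (σ ⟨c, hc⟩ : ℕ)) (J := J)
      (b := n * g + 1) ?_ ?_ ?_ ?_ ?_).mono ?_
    · rw [hs₂.reg 35 (by decide)]; simp
    · rw [hs₂.reg 33 (by decide)]; simp [h33]
    · rw [hs₂.reg 32 (by decide)]; simp [h32]
    · rw [hs₂.reg 30 (by decide)]; simp [h30]
    · rw [hs₂.reg 5 (by decide)]; simp [h5]
    rintro M₃ t₃ hs₃ ⟨h36', ht₃⟩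
    have h34 : M₃.reg 34 = k := by
      rw [hs₃.reg 34 (by decide), hs₂.reg 34 (by decide)]; simp [hik]
    have h21 : M₃.arr 21 = M₁.arr 21 := by
      rw [hs₃.arr 21 (by decide), hs₂.arr 21 (by decide)]; simp
    simp only [wp_write, Expr.eval, Expr.cost, h34, h21, h36', h36]
    refine ⟨fun i hi => ?_, by omega⟩
    simp only [arr_setReg, arr_setArr, if_true, Function.update_apply, reg_setReg]
    split_ifs with h h' h''
    · rw [Nat.cast_inj.1 h, weight, if_neg (by tauto)]
    · rw [Nat.cast_inj.1 h, weight, if_pos ⟨h'', h'⟩]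
    · rw [Nat.cast_inj.1 h, weight, if_neg (by tauto)]
      simp
    · exact hI i (by have : i ≠ k := by simpa using h
                     omega)
  · intro M₁ t hs hI ht
    exact ⟨hI, by omega⟩

/-- The message of the bag number `c` at `y`, from the tables `F` and the weights `u`. -/
def msg (N b : ℕ) (F u : ℤ → ℤ) (y : ℕ) : ℤ :=
  partialSups (fun i : ℕ => F ((b + (i + N * y) : ℕ) : ℤ) + u i) (N - 1)

/-- Array `20` becomes the message of bag number `reg 31`. -/
def message : Prog := .block [
  .assign 40 (.read 10 (.reg 31)),
  .assign 39 (.read 7 (.sub (.read 9 (.reg 31)) (.const 1))),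
  .assign 41 (.sub (.reg 4) (.const 1)),
  .loop 42 39 (.block [
    .assign 43 (.add (.read 19 (.reg 40)) (.read 21 (.const 0))),
    .loop 44 41 (.block [
      .assign 45 (.add (.read 19 (.add (.reg 40) (.add (.reg 44) (.const 1))))
        (.read 21 (.add (.reg 44) (.const 1)))),
      .ite (.reg 43) (.reg 45) (.assign 43 (.reg 45)) .skip]),
    .write 20 (.reg 42) (.reg 43),
    .assign 40 (.add (.reg 40) (.reg 4))])]

theorem wp_message {M : Memory} (hE : Env g N H σ M) (hN : 0 < N) {c : ℕ} (hc : c < n)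
    (hreg : M.reg 31 = c) :
    WP message M fun M' t =>
      (∀ y < N ^ (bag H σ c).tail.length,
        M'.arr 20 y = msg N (tableStart N H σ c) (M.arr 19) (M.arr 21) y) ∧
      t ≤ 40 + 100 * N ^ (bag H σ c).length := by
  have hlen : (bag H σ c).length = (bag H σ c).tail.length + 1 := by
    conv_lhs => rw [bag_eq_cons hc, List.length_cons]
  have hle := length_bag_le (H := H) (σ := σ) c
  set s := (bag H σ c).tail.length with hs
  simp only [message, wp_block_cons, wp_block_one, wp_assign, Expr.eval, reg_setReg, hreg,
    arr_setReg, hE.table c hc.le, hE.length c hc.le, Expr.cost, Nat.reduceEqDiff, ↓reduceIte, hlen,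
    Nat.cast_add, Nat.cast_one, add_sub_cancel_right, hE.pow s (by omega), hE.radix]
  -- Register `40` points to the block of `N` entries that share the tail code `k`; it advances by
  -- `N`, which replaces a multiplication.
  refine wp_loop (N ^ s) (fun k M' => M'.reg 40 = (tableStart N H σ c + N * k : ℕ) ∧
      ∀ y < k, M'.arr 20 y = msg N (tableStart N H σ c) (M.arr 19) (M.arr 21) y)
    (fun k => (60 + 40 * N) * k) (by simp) (by simp) ?_ ?_
  · rintro k hk M₁ hs₁ hik ⟨h40, hI⟩
    have h19 : M₁.arr 19 = M.arr 19 := by rw [hs₁.arr 19 (by decide)]; simp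
    have h21 : M₁.arr 21 = M.arr 21 := by rw [hs₁.arr 21 (by decide)]; simp
    have h41 : M₁.reg 41 = (N - 1 : ℕ) := by
      rw [hs₁.reg 41 (by decide)]; simp [Nat.cast_sub (show 1 ≤ N by omega)]
    have h4 : M₁.reg 4 = N := by rw [hs₁.reg 4 (by decide)]; simp [hE.radix]
    simp only [wp_block_cons, wp_block_one, wp_assign, wp_write, Expr.eval,
      reg_setReg, arr_setReg, reg_setArr, arr_setArr, Expr.cost, Nat.reduceEqDiff, ↓reduceIte,
      h40, h19, h21]
    -- The value 0 has initialized the running maximum, so `N - 1` comparisons remain, and round `j`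
    -- looks at the value `j + 1`.
    refine wp_loop (N - 1) (fun j M' => M'.reg 43 = partialSups (fun i : ℕ =>
        M.arr 19 ((tableStart N H σ c + (i + N * k) : ℕ) : ℤ) + M.arr 21 i) j)
      (fun j => 30 * j) (by simp [h41]) (by simp) ?_ ?_
    · intro j hj M₂ hs₂ hij hI₂
      have g40 : M₂.reg 40 = (tableStart N H σ c + N * k : ℕ) := by
        rw [hs₂.reg 40 (by decide)]; simp [h40]
      have g19 : M₂.arr 19 = M.arr 19 := by rw [hs₂.arr 19 (by decide)]; simp [h19]
      have g21 : M₂.arr 21 = M.arr 21 := by rw [hs₂.arr 21 (by decide)]; simp [h21]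
      have e : ((tableStart N H σ c + N * k : ℕ) : ℤ) + ((j : ℤ) + 1) =
          ((tableStart N H σ c + (j + 1 + N * k) : ℕ) : ℤ) := by push_cast; ring
      simp only [wp_block_cons, wp_block_one, wp_assign, wp_ite, wp_skip, Expr.eval,
        reg_setReg, Expr.cost, Nat.reduceEqDiff, ↓reduceIte, g40, g19, g21, hij, hI₂,
        e, partialSups_add_one, Nat.cast_add_one]
      split_ifs with h
      · exact ⟨(max_eq_right h.le).symm, by omega⟩
      · exact ⟨(max_eq_left (not_lt.1 h)).symm, by omega⟩
    · intro M₂ t hs₂ hI₂ ht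
      have g40 : M₂.reg 40 = (tableStart N H σ c + N * k : ℕ) := by
        rw [hs₂.reg 40 (by decide)]; simp [h40]
      have g20 : M₂.arr 20 = M₁.arr 20 := by rw [hs₂.arr 20 (by decide)]; simp
      have g42 : M₂.reg 42 = k := by rw [hs₂.reg 42 (by decide)]; simp [hik]
      have g4 : M₂.reg 4 = N := by rw [hs₂.reg 4 (by decide)]; simp [h4]
      refine ⟨⟨?_, fun y hy => ?_⟩, ?_⟩
      · rw [g40, g4]
        push_cast
        ring
      · rw [Function.update_apply, g42, g20, hI₂]
        split_ifs with h
        · rw [Nat.cast_inj.1 h, msg]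
        · exact hI y (by have : y ≠ k := by simpa using h
                         omega)
      · have : (60 + 40 * N) * (k + 1) = (60 + 40 * N) * k + 60 + 40 * N := by ring
        omega
  · rintro M₁ t hs₁ ⟨-, hI⟩ ht
    refine ⟨hI, ?_⟩
    have : N ^ s * 1 ≤ N ^ s * N := Nat.mul_le_mul_left _ hN
    rw [pow_succ]
    nlinarith

/-- Set the entries of array `17` for the coefficients of the address in the message of bag number
`reg 31`, and `reg 16` to the number of the bag that receives it. -/
def address : Prog := .block [
  .assign 24 (.add (.read 4 (.reg 31)) (.const 1)),
  .assign 25 (.sub (.read 9 (.reg 31)) (.const 1)),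
  .assign 16 (.reg 0),
  .ite (.const 0) (.reg 25) (.assign 16 (.read 8 (.read 5 (.reg 24)))) .skip,
  .loop 46 25 (.write 17 (.read 5 (.add (.reg 24) (.reg 46))) (.read 7 (.reg 46)))]

theorem vertex_tail {M : Memory} (hE : Env g N H σ M) {c : ℕ} (hc : c < n) {k : ℕ}
    (hk : k < (bag H σ c).tail.length) :
    M.arr 5 ((bagStart H σ c : ℤ) + 1 + k) = ((bag H σ c).tail[k] : ℕ) := by
  have hlen : k + 1 < (bag H σ c).length := by
    rw [bag_eq_cons hc, List.length_cons]
    omega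
  have := hE.vertex c (k + 1) hlen
  rw [List.getElem_tail, ← this]
  congr 1
  push_cast
  ring

theorem wp_address {M : Memory} (hE : Env g N H σ M) {c : ℕ} (hc : c < n)
    (hreg : M.reg 31 = c) (h0 : ∀ v : Fin n, M.arr 17 v = 0) :
    WP address M fun M' t =>
      M'.reg 24 = bagStart H σ c + 1 ∧ M'.reg 25 = (bag H σ c).tail.length ∧
      M'.reg 16 = parent H σ c ∧
      (∀ v : Fin n, M'.arr 17 v =
        if v ∈ (bag H σ c).tail then (N : ℤ) ^ (bag H σ c).tail.idxOf v else 0) ∧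
      t ≤ 60 + 20 * (bag H σ c).length := by
  have hlen : (bag H σ c).length = (bag H σ c).tail.length + 1 := by
    conv_lhs => rw [bag_eq_cons hc, List.length_cons]
  have hle := length_bag_le (H := H) (σ := σ) c
  have hnd : (bag H σ c).tail.Nodup := (nodup_bag c).tail
  have hvt := fun k hk => vertex_tail hE hc (k := k) hk
  have hpar : ∀ h : 0 < (bag H σ c).tail.length,
      (σ.symm ((bag H σ c).tail[0]) : ℕ) = parent H σ c := by
    unfold parent
    generalize (bag H σ c).tail = L
    cases L <;> simp
  -- A bag with a single vertex sends its message to the root; this is the default that the program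
  -- puts into register `16`.
  have hpar0 : ¬ 0 < (bag H σ c).tail.length → parent H σ c = n := by
    unfold parent
    generalize (bag H σ c).tail = L
    cases L <;> simp
  have hpos : ∀ v : Fin n, M.arr 8 v = (σ.symm v : ℕ) := hE.position
  have hbag : ∀ k ≤ n, M.arr 7 k = N ^ k := hE.pow
  set L := (bag H σ c).tail with hL
  simp only [address, wp_block_cons, wp_block_one, wp_assign, wp_ite, wp_skip, Expr.eval,
    reg_setReg, hreg, arr_setReg, hE.start c hc.le, hE.length c hc.le, Expr.cost, Nat.reduceEqDiff,
    ↓reduceIte, hlen, Nat.cast_add, Nat.cast_one, add_sub_cancel_right, hE.dim]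
  -- The final loop is treated once for both branches of the conditional.
  have main : ∀ M₁ : Memory, M₁.reg 24 = bagStart H σ c + 1 → M₁.reg 25 = L.length →
      M₁.reg 16 = parent H σ c → M₁.arr = M.arr → ∀ Q : Memory → ℕ → Prop,
      (∀ (M' : Memory) (t : ℕ), (M'.reg 24 = bagStart H σ c + 1 ∧ M'.reg 25 = L.length ∧
        M'.reg 16 = parent H σ c ∧
        (∀ v : Fin n, M'.arr 17 v = if v ∈ L then (N : ℤ) ^ L.idxOf v else 0)) →
        t ≤ 20 * L.length + 5 → Q M' t) →
      WP (.loop 46 25 (.write 17 (.read 5 (.add (.reg 24) (.reg 46))) (.read 7 (.reg 46)))) M₁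
        Q := by
    intro M₁ h24 h25 h16 harr Q hQ
    refine wp_loop L.length (fun k M' => ∀ v : Fin n, M'.arr 17 v =
      if v ∈ L.take k then (N : ℤ) ^ L.idxOf v else 0) (fun k => 20 * k) h25
      (by simpa [harr] using h0) ?_ ?_
    · intro k hk M₂ hs hik hI
      have g24 : M₂.reg 24 = bagStart H σ c + 1 := by rw [hs.reg 24 (by decide), h24]
      have g5 : M₂.arr 5 = M.arr 5 := by rw [hs.arr 5 (by decide), harr]
      have g7 : M₂.arr 7 = M.arr 7 := by rw [hs.arr 7 (by decide), harr]
      simp only [wp_write, Expr.eval, g24, g5, g7, hik, hvt k hk, hbag k (by omega), Expr.cost]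
      refine ⟨fun v => ?_, by omega⟩
      simp only [arr_setReg, arr_setArr, if_true, Function.update_apply, Nat.cast_inj,
        Fin.val_inj, List.take_succ_eq_append_getElem hk, List.mem_append, List.mem_singleton, hI]
      by_cases h : v = L[k]
      · subst h
        simp [hnd.idxOf_getElem]
      · simp [h]
    · intro M₂ t hs hI ht
      refine hQ _ _ ⟨?_, ?_, ?_, ?_⟩ ht
      · rw [hs.reg 24 (by decide), h24]
      · rw [hs.reg 25 (by decide), h25]
      · rw [hs.reg 16 (by decide), h16]
      · simpa using hI
  split_ifs with h
  · have h' : 0 < L.length := by exact_mod_cast h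
    refine main _ ?_ ?_ ?_ ?_ _ ?_
    · simp
    · simp
    · have := hvt 0 h'
      simp only [Nat.cast_zero, add_zero] at this
      simp [this, hpos, hpar h']
    · rfl
    · rintro M' t ⟨h1, h2, h3, h4⟩ ht
      exact ⟨h1, h2, h3, h4, by omega⟩
  · have h' : ¬ 0 < L.length := by simpa using h
    refine main _ ?_ ?_ ?_ ?_ _ ?_
    · simp
    · simp
    · simp [hpar0 h']
    · rfl
    · rintro M' t ⟨h1, h2, h3, h4⟩ ht
      exact ⟨h1, h2, h3, h4, by omega⟩

/-- Add the message in array `20` to the table of bag number `reg 16` in array `19`, where the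
addresses in the message are in array `18`. -/
def merge : Prog := .block [
  .assign 47 (.read 10 (.reg 16)),
  .assign 48 (.read 7 (.read 9 (.reg 16))),
  .loop 49 48 (.write 19 (.add (.reg 47) (.reg 49))
    (.add (.read 19 (.add (.reg 47) (.reg 49))) (.read 20 (.read 18 (.reg 49)))))]

theorem wp_merge {M : Memory} (hE : Env g N H σ M) {p : ℕ} (hp : p ≤ n) (hreg : M.reg 16 = p) :
    WP merge M fun M' t =>
      (∀ l q, q < N ^ (bag H σ l).length →
        M'.arr 19 ((tableStart N H σ l + q : ℕ) : ℤ) =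
          M.arr 19 ((tableStart N H σ l + q : ℕ) : ℤ) +
            if l = p then M.arr 20 (M.arr 18 q) else 0) ∧
      t ≤ 20 + 30 * N ^ (bag H σ p).length := by
  have hlen := length_bag_le (H := H) (σ := σ) p
  simp only [merge, wp_block_cons, wp_block_one, wp_assign, Expr.eval, reg_setReg, hreg,
    arr_setReg, hE.table p hp, hE.length p hp, hE.pow _ hlen, Expr.cost, Nat.reduceEqDiff,
    ↓reduceIte]
  refine wp_loop (N ^ (bag H σ p).length)
    (fun k M' => ∀ a : ℕ, M'.arr 19 a = M.arr 19 a +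
      if tableStart N H σ p ≤ a ∧ a < tableStart N H σ p + k
      then M.arr 20 (M.arr 18 ((a - tableStart N H σ p : ℕ) : ℤ)) else 0) (fun k => 30 * k)
    (by simp) ?_ ?_ ?_
  · intro a
    simp only [arr_setReg, add_zero]
    rw [if_neg (by omega), add_zero]
  · intro k hk M₁ hs hik hI
    have h47 : M₁.reg 47 = tableStart N H σ p := by rw [hs.reg 47 (by decide)]; simp
    have h18 : M₁.arr 18 = M.arr 18 := by rw [hs.arr 18 (by decide)]; simp
    have h20 : M₁.arr 20 = M.arr 20 := by rw [hs.arr 20 (by decide)]; simp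
    simp only [wp_write, Expr.eval, h47, h18, h20, hik, Expr.cost]
    refine ⟨fun a => ?_, by omega⟩
    simp only [arr_setReg, arr_setArr, if_true, Function.update_apply]
    by_cases h : a = tableStart N H σ p + k
    · subst h
      rw [if_pos (by push_cast; rfl), if_pos (by omega), ← Nat.cast_add, hI, if_neg (by omega)]
      simp
    · rw [if_neg (by omega), hI]
      congr 1
      by_cases h' : tableStart N H σ p ≤ a ∧ a < tableStart N H σ p + k
      · rw [if_pos h', if_pos (by omega)]
      · rw [if_neg h', if_neg (by omega)]
  · intro M₁ t hs hI ht
    refine ⟨fun l q hq => ?_, by omega⟩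
    rw [hI]
    congr 1
    simp only [tableStart_add_mem hq]
    split_ifs with h
    · subst h
      simp
    · rfl

end

/-! ### Variable elimination and the optimum -/

section

variable {n g N W : ℕ} {H : SimpleGraph (Fin n)} {σ : Equiv.Perm (Fin n)}

/-- One elimination step: the bag number `reg 31` sends its message. -/
def eliminate : Prog := .block [domain, message, address, .write 18 (.const 0) (.const 0), fill,
  merge, clear 5]

theorem partialSups_congr_le {α : Type*} [SemilatticeSup α] {f f' : ℕ → α} {k : ℕ}
    (h : ∀ i ≤ k, f i = f' i) : partialSups f k = partialSups f' k := by
  rw [partialSups_apply, partialSups_apply]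
  exact Finset.sup'_congr _ rfl fun i hi => h i (Finset.mem_Iic.1 hi)

/-- The tables are only described at codes of assignments `d`, which is all that `value` sees: the
parent's entry grows by the maximum over the eliminated variable, the other entries are unchanged.
-/
theorem wp_eliminate {M : Memory} (hP : IsPerfectElimination H σ) (hE : Env g N H σ M)
    (hN : 0 < N) (hNW : N ≤ W)
    (hW : ∀ l, (bag H σ l).length ≤ W ∧ N ^ (bag H σ l).length ≤ W) {z : Fin n → ℤ}
    (hz : ∀ v : Fin n, M.arr 6 v = z v) {J : ℤ} (hJ : M.reg 30 = J) {c : ℕ} (hc : c < n)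
    (hreg : M.reg 31 = c) (h0 : ∀ v : Fin n, M.arr 17 v = 0) :
    WP eliminate M fun M' t =>
      (∀ v : Fin n, M'.arr 17 v = 0) ∧
      (∀ d : Fin n → ℕ, (∀ v, d v < N) → ∀ l,
        M'.arr 19 ((tableStart N H σ l + enc N d (bag H σ l) : ℕ) : ℤ) =
          M.arr 19 ((tableStart N H σ l + enc N d (bag H σ l) : ℕ) : ℤ) +
          if l = parent H σ c then partialSups (fun i : ℕ =>
            M.arr 19 ((tableStart N H σ c +
              enc N (Function.update d (σ ⟨c, hc⟩) i) (bag H σ c) : ℕ) : ℤ) +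
            weight g z J (σ ⟨c, hc⟩) i) (N - 1) else 0) ∧
      t ≤ 1000 * W := by
  have hW1 : 1 ≤ W := hN.trans_le hNW
  simp only [eliminate, wp_block_cons, wp_block_one]
  refine (wp_domain hE hz hJ hc hreg).mono ?_
  rintro M₁ t₁ hs₁ ⟨h21, ht₁⟩
  have hE₁ := hE.of_low hs₁.low
  have r₁ : M₁.reg 31 = c := by rw [hs₁.reg 31 (by decide), hreg]
  refine (wp_message hE₁ hN hc r₁).mono ?_
  rintro M₂ t₂ hs₂ ⟨h20, ht₂⟩
  have hE₂ := hE₁.of_low hs₂.low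
  have r₂ : M₂.reg 31 = c := by rw [hs₂.reg 31 (by decide), r₁]
  refine (wp_address hE₂ hc r₂ ?_).mono ?_
  · rw [hs₂.arr 17 (by decide), hs₁.arr 17 (by decide)]
    exact h0
  rintro M₃ t₃ hs₃ ⟨h24, h25, h16, h17, ht₃⟩
  have hE₃ := hE₂.of_low hs₃.low
  simp only [wp_write, Expr.eval]
  have hlow : Low M₃ (M₃.setArr 18 (Function.update (M₃.arr 18) 0 0)) :=
    (Low.refl M₃).setArr (by norm_num) _
  refine (wp_fill (p := parent H σ c) (a := fun v => if v ∈ (bag H σ c).tail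
    then (N : ℤ) ^ (bag H σ c).tail.idxOf v else 0) (t₀ := 0) (hE₃.of_low hlow) hN
    (parent_le c) ?_ ?_ ?_).mono ?_
  · simpa using h16
  · simpa using h17
  · simp
  rintro M₄ t₄ hs₄ ⟨h18, ht₄⟩
  have hE₄ := hE₃.of_low (hlow.trans hs₄.low)
  refine (wp_merge (p := parent H σ c) hE₄ (parent_le c) ?_).mono ?_
  · rw [hs₄.reg 16 (by decide)]
    simpa using h16
  rintro M₅ t₅ hs₅ ⟨h19, ht₅⟩
  have hE₅ := hE₄.of_low hs₅.low
  refine (wp_clear (L := (bag H σ c).tail) (s := bagStart H σ c + 1) (by norm_num) ?_ ?_ ?_ ?_).mono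
    ?_
  · rw [hs₅.reg 24 (by decide), hs₄.reg 24 (by decide)]
    simpa using h24
  · rw [hs₅.reg 25 (by decide), hs₄.reg 25 (by decide)]
    simpa using h25
  · exact fun k hk => vertex_tail hE₅ hc hk
  · intro v hv
    rw [hs₅.arr 17 (by decide), hs₄.arr 17 (by decide)]
    simp [h17, hv]
  rintro M₆ t₆ hs₆ ⟨h17', ht₆⟩
  refine ⟨h17', fun d hd l => ?_, ?_⟩
  · rw [hs₆.arr 19 (by decide), h19 l _ (enc_lt hd _)]
    have e19 : M₄.arr 19 = M.arr 19 := by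
      rw [hs₄.arr 19 (by decide)]
      simp only [arr_setArr, Nat.reduceEqDiff, ↓reduceIte]
      rw [hs₃.arr 19 (by decide), hs₂.arr 19 (by decide), hs₁.arr 19 (by decide)]
    have e20 : M₄.arr 20 = M₂.arr 20 := by
      rw [hs₄.arr 20 (by decide)]
      simp only [arr_setArr, Nat.reduceEqDiff, ↓reduceIte]
      rw [hs₃.arr 20 (by decide)]
    rw [e19]
    congr 1
    split_ifs with hl
    swap
    · rfl
    have hnd : (bag H σ c).tail.Nodup := (nodup_bag c).tail
    -- Digits of the parent bag outside the tail have coefficient 0, and the whole tail is in the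
    -- parent bag, so the tabulated number is the code of the tail.
    have e18 : M₄.arr 18 (enc N d (bag H σ l) : ℕ) = (enc N d (bag H σ c).tail : ℕ) := by
      rw [h18 _ (by rw [hl]; exact enc_lt hd _), hl, lin_enc hd, zero_add, ← sum_map_idxOf hnd,
        ← List.sum_toFinset _ (nodup_bag _), ← List.sum_toFinset _ hnd]
      push_cast
      symm
      have hsub : (bag H σ c).tail.toFinset ⊆ (bag H σ (parent H σ c)).toFinset := by
        intro v hv
        simp only [List.mem_toFinset] at hv ⊢
        exact tail_subset_parent hP hc hv
      rw [← Finset.sum_subset hsub]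
      · refine Finset.sum_congr rfl fun v hv => ?_
        rw [if_pos (by simpa using hv)]
      · intro v _ hv
        rw [if_neg (by simpa using hv), zero_mul]
    rw [e20, e18, h20 _ (enc_lt hd _), msg, hs₁.arr 19 (by decide)]
    refine partialSups_congr_le fun i hi => ?_
    rw [h21 i (by omega)]
    have hcons := bag_eq_cons (H := H) (σ := σ) hc
    have hni : σ ⟨c, hc⟩ ∉ (bag H σ c).tail := by
      have := nodup_bag (H := H) (σ := σ) c
      rw [hcons] at this
      exact (List.nodup_cons.1 this).1
    have henc : enc N (Function.update d (σ ⟨c, hc⟩) i) (bag H σ c) =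
        i + N * enc N d (bag H σ c).tail := by
      conv_lhs => rw [hcons]
      simp only [enc, Function.update_self]
      rw [enc_congr (d' := d)]
      intro v hv
      exact Function.update_of_ne (by rintro rfl; exact hni hv) _ _
    rw [henc]
  · have a1 := hW c
    have a2 := hW (parent H σ c)
    have a3 : (bag H σ c).tail.length ≤ (bag H σ c).length := by simp
    simp only [Expr.cost]
    omega

/-- The total weight of an assignment when the bags with numbers `< c` have been eliminated and
the tables are in `F`. -/
noncomputable def value (N : ℕ) (H : SimpleGraph (Fin n)) (σ : Equiv.Perm (Fin n))
    (u : Fin n → ℕ → ℤ) (c : ℕ) (F : ℤ → ℤ) (d : Fin n → ℕ) : ℤ :=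
  ∑ l ∈ Finset.Icc c n, F ((tableStart N H σ l + enc N d (bag H σ l) : ℕ) : ℤ) +
    ∑ v with c ≤ (σ.symm v : ℕ), u v (d v)

/-- The bags after `c` do not contain the vertex `σ c`, so changing its value affects only table `c`
and one weight. This lets the maximum over that value move inside the sum. -/
theorem value_update (u : Fin n → ℕ → ℤ) {c : ℕ} (hc : c < n) (F : ℤ → ℤ) (d : Fin n → ℕ)
    (i : ℕ) :
    value N H σ u c F (Function.update d (σ ⟨c, hc⟩) i) = value N H σ u (c + 1) F d +
      (F ((tableStart N H σ c +
        enc N (Function.update d (σ ⟨c, hc⟩) i) (bag H σ c) : ℕ) : ℤ) + u (σ ⟨c, hc⟩) i) := by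
  have h1 : (Finset.univ.filter fun v => c ≤ (σ.symm v : ℕ)) =
      insert (σ ⟨c, hc⟩) (Finset.univ.filter fun v => c + 1 ≤ (σ.symm v : ℕ)) := by
    ext v
    simp only [Finset.mem_filter, Finset.mem_univ, true_and, Finset.mem_insert,
      ← Equiv.symm_apply_eq, Fin.ext_iff]
    omega
  unfold value
  rw [← Finset.insert_Icc_succ_left_eq_Icc hc.le, Finset.sum_insert (by simp), h1,
    Finset.sum_insert (by simp), Function.update_self]
  have h2 : ∀ l ∈ Finset.Icc (c + 1) n,
      enc N (Function.update d (σ ⟨c, hc⟩) i) (bag H σ l) = enc N d (bag H σ l) := by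
    intro l hl
    refine enc_congr fun v hv => Function.update_of_ne ?_ _ _
    rintro rfl
    exact not_mem_bag hc (Finset.mem_Icc.1 hl).1 hv
  have h3 : ∀ v ∈ Finset.univ.filter (fun v => c + 1 ≤ (σ.symm v : ℕ)),
      u v (Function.update d (σ ⟨c, hc⟩) i v) = u v (d v) := by
    intro v hv
    rw [Function.update_of_ne]
    rintro rfl
    simp at hv
  rw [Finset.sum_congr rfl h3, Order.succ_eq_add_one,
    Finset.sum_congr rfl fun l hl => by rw [h2 l hl]]
  ring

/-- Maximize the total weight of an assignment for the tables in array `16`. -/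
def maximize : Prog := .block [
  .assign 50 (.add (.read 10 (.reg 0)) (.const 1)),
  .loop 51 50 (.write 19 (.reg 51) (.read 16 (.reg 51))),
  .loop 31 0 eliminate,
  .assign 52 (.read 19 (.read 10 (.reg 0)))]

theorem wp_maximize {M : Memory} (hP : IsPerfectElimination H σ) (hE : Env g N H σ M)
    (hN : 0 < N) (hn : 0 < n) (hNW : N ≤ W)
    (hW : ∀ l, (bag H σ l).length ≤ W ∧ N ^ (bag H σ l).length ≤ W) {z : Fin n → ℤ}
    (hz : ∀ v : Fin n, M.arr 6 v = z v) {J : ℤ} (hJ : M.reg 30 = J)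
    (h0 : ∀ v : Fin n, M.arr 17 v = 0) :
    WP maximize M fun M' t =>
      (∀ v : Fin n, M'.arr 17 v = 0) ∧
      (∀ d : Fin n → ℕ, (∀ v, d v < N) →
        value N H σ (weight g z J) 0 (M.arr 16) d ≤ M'.reg 52) ∧
      (∃ d : Fin n → ℕ, (∀ v, d v < N) ∧
        value N H σ (weight g z J) 0 (M.arr 16) d = M'.reg 52) ∧
      t ≤ 1200 * (n * W) := by
  have hnW : 1 ≤ n * W := Nat.mul_pos hn (hN.trans_le hNW)
  have hts : tableStart N H σ n ≤ n * W := by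
    unfold tableStart
    refine (Finset.sum_le_sum fun l _ => (hW l).2).trans ?_
    simp
  simp only [maximize, wp_block_cons, wp_block_one, wp_assign, Expr.eval, reg_setReg, arr_setReg,
    hE.dim, hE.table n le_rfl, Expr.cost, ↓reduceIte]
  -- The penalty tables are copied, since elimination destroys them and they are needed again. The
  -- extra 1 is the single entry of the root table.
  refine wp_loop (tableStart N H σ n + 1)
    (fun k M' => ∀ a < k, M'.arr 19 a = M.arr 16 a) (fun k => 20 * k) (by simp) (by simp) ?_ ?_
  · intro k hk M₁ hs₁ hik hI
    have h16 : M₁.arr 16 = M.arr 16 := by rw [hs₁.arr 16 (by decide)]; simp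
    simp only [wp_write, Expr.eval, Expr.cost, hik, h16]
    refine ⟨fun a ha => ?_, by omega⟩
    simp only [arr_setReg, arr_setArr, if_true, Function.update_apply, Nat.cast_inj]
    split_ifs with h
    · rw [h]
    · exact hI a (by omega)
  intro M₁ t₁ hs₁ hI ht₁
  have hlow₁ : Low M M₁ := ((Low.refl M).setReg (by norm_num) _).trans hs₁.low
  have h16 : M₁.arr 16 = M.arr 16 := by rw [hs₁.arr 16 (by decide)]; simp
  have h6 : M₁.arr 6 = M.arr 6 := by rw [hs₁.arr 6 (by decide)]; simp
  have h30 : M₁.reg 30 = J := by rw [hs₁.reg 30 (by decide)]; simp [hJ]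
  have h17 : M₁.arr 17 = M.arr 17 := by rw [hs₁.arr 17 (by decide)]; simp
  have hE₁ := hE.of_low hlow₁
  -- The invariant says that the maximum of `value` is preserved: the original values are bounded by
  -- the current ones, and each current value is an original value of some assignment.
  refine wp_loop n (fun k M' => (∀ v : Fin n, M'.arr 17 v = 0) ∧
      (∀ d : Fin n → ℕ, (∀ v, d v < N) → value N H σ (weight g z J) 0 (M.arr 16) d ≤
        value N H σ (weight g z J) k (M'.arr 19) d) ∧
      (∀ d : Fin n → ℕ, (∀ v, d v < N) → ∃ d' : Fin n → ℕ, (∀ v, d' v < N) ∧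
        value N H σ (weight g z J) 0 (M.arr 16) d' =
        value N H σ (weight g z J) k (M'.arr 19) d))
    (fun k => (1000 * W + 7) * k) hE₁.dim ?_ ?_ ?_
  · have key : ∀ d : Fin n → ℕ, (∀ v, d v < N) → value N H σ (weight g z J) 0 (M₁.arr 19) d =
        value N H σ (weight g z J) 0 (M.arr 16) d := by
      intro d hd
      unfold value
      congr 1
      refine Finset.sum_congr rfl fun l hl => hI _ ?_
      rcases (Finset.mem_Icc.1 hl).2.lt_or_eq with h | rfl
      · have := tableStart_add_le (N := N) (H := H) (σ := σ) h
        have := enc_lt hd (bag H σ l)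
        omega
      · simp [bag_of_le le_rfl, enc]
    simp only [arr_setReg]
    exact ⟨by rw [h17]; exact h0, fun d hd => (key d hd).ge, fun d hd => ⟨d, hd, (key d hd).symm⟩⟩
  · rintro k hk M₂ hs₂ hik ⟨hI1, hI2, hI3⟩
    have hE₂ := hE₁.of_low (hs₂.low)
    refine (wp_eliminate hP hE₂ hN hNW hW (z := z) (J := J) ?_ ?_ hk hik hI1).mono ?_
    · rw [hs₂.arr 6 (by decide), h6]
      exact hz
    · rw [hs₂.reg 30 (by decide), h30]
    rintro M₃ t₃ hs₃ ⟨h17', h19, ht₃⟩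
    have key : ∀ d : Fin n → ℕ, (∀ v, d v < N) →
        value N H σ (weight g z J) (k + 1) (M₃.arr 19) d =
        value N H σ (weight g z J) (k + 1) (M₂.arr 19) d + partialSups (fun i : ℕ =>
            M₂.arr 19 ((tableStart N H σ k +
              enc N (Function.update d (σ ⟨k, hk⟩) i) (bag H σ k) : ℕ) : ℤ) +
            weight g z J (σ ⟨k, hk⟩) i) (N - 1) := by
      intro d hd
      unfold value
      rw [Finset.sum_congr rfl fun l _ => h19 d hd l, Finset.sum_add_distrib, Finset.sum_ite_eq',
        if_pos (Finset.mem_Icc.2 ⟨lt_parent hk, parent_le k⟩)]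
      ring
    simp only [arr_setReg]
    refine ⟨⟨h17', fun d hd => (hI2 d hd).trans ?_, fun d hd => ?_⟩, ?_⟩
    · rw [key d hd]
      have := value_update (N := N) (H := H) (σ := σ) (weight g z J) hk (M₂.arr 19) d (d (σ ⟨k, hk⟩))
      rw [Function.update_eq_self] at this
      rw [this]
      -- The maximum is at least its term at the present value of the variable, where the update
      -- does nothing.
      have h := le_partialSups_of_le (fun i : ℕ =>
            M₂.arr 19 ((tableStart N H σ k +
              enc N (Function.update d (σ ⟨k, hk⟩) i) (bag H σ k) : ℕ) : ℤ) +
            weight g z J (σ ⟨k, hk⟩) i) (Nat.le_sub_one_of_lt (hd (σ ⟨k, hk⟩)))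
      simp only [Function.update_eq_self] at h
      linarith
    · rw [key d hd]
      -- A maximizing value of the eliminated variable extends the assignment to one of equal value.
      obtain ⟨i, hi, h⟩ := exists_partialSups_eq (fun i : ℕ =>
            M₂.arr 19 ((tableStart N H σ k +
              enc N (Function.update d (σ ⟨k, hk⟩) i) (bag H σ k) : ℕ) : ℤ) +
            weight g z J (σ ⟨k, hk⟩) i) (N - 1)
      rw [h, ← value_update]
      refine hI3 _ fun v => ?_
      rw [Function.update_apply]
      split_ifs
      · omega
      · exact hd v
    · ring_nf
      ring_nf at ht₃
      omega
  rintro M₂ t₂ hs₂ ⟨hI1, hI2, hI3⟩ ht₂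
  have hE₂ := hE₁.of_low hs₂.low
  have hfin : ∀ d, value N H σ (weight g z J) n (M₂.arr 19) d =
      M₂.arr 19 (tableStart N H σ n) := by
    intro d
    unfold value
    rw [Finset.Icc_self, Finset.sum_singleton, Finset.sum_eq_zero]
    · simp [bag_of_le le_rfl, enc]
    · intro v hv
      have := (σ.symm v).is_lt
      simp at hv
      omega
  simp only [hE₂.dim, hE₂.table n le_rfl]
  simp only [hfin] at hI2 hI3
  refine ⟨hI1, hI2, hI3 (fun _ => 0) fun _ => hN, ?_⟩
  have : (1000 * W + 7) * n = 1000 * (n * W) + 7 * n := by ring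
  have : n ≤ n * W := Nat.le_mul_of_pos_right n (hN.trans_le hNW)
  omega

end

section

/-! ### Preprocessing -/

theorem listArr_natCast (l : List ℤ) (i : ℕ) : listArr l i = l.getD i 0 := by
  simp [listArr]

theorem vecArr_natCast {n : ℕ} (z : Fin n → ℤ) (v : Fin n) : vecArr z ((v : ℕ) : ℤ) = z v := by
  simp [vecArr, listArr_natCast]

theorem listArr_offsets (L : List (List ℤ)) {i : ℕ} (hi : i ≤ L.length) :
    listArr (offsets L) i = ((L.take i).flatten.length : ℕ) := by
  rw [listArr_natCast, offsets, List.getD_eq_getElem _ _ (by simpa using Nat.lt_succ_of_le hi)]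
  simp

theorem length_flatten_take_succ (L : List (List ℤ)) {i : ℕ} (hi : i < L.length) :
    (L.take (i + 1)).flatten.length = (L.take i).flatten.length + L[i].length := by
  rw [List.take_succ_eq_append_getElem hi]
  simp only [List.flatten_append, List.flatten_cons, List.flatten_nil, List.append_nil,
    List.length_append]

theorem listArr_flatten (L : List (List ℤ)) {i k : ℕ} (hi : i < L.length) (hk : k < L[i].length) :
    listArr L.flatten (((L.take i).flatten.length : ℤ) + k) = L[i][k] := by
  have h : L.flatten = (L.take i).flatten ++ (L[i] ++ (L.drop (i + 1)).flatten) := by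
    conv_lhs => rw [← List.take_append_drop i L, List.drop_eq_getElem_cons hi]
    rw [List.flatten_append, List.flatten_cons]
  rw [← Nat.cast_add, listArr_natCast, h, List.getD_append_right _ _ _ _ (by omega),
    Nat.add_sub_cancel_left, List.getD_append _ _ _ _ hk, List.getD_eq_getElem _ _ hk]

variable {m n g N W : ℕ} {H : SimpleGraph (Fin n)} {σ : Equiv.Perm (Fin n)}
  {A : Matrix (Fin m) (Fin n) ℤ}

theorem length_flatten_take_elimList {l : ℕ} (hl : l ≤ n) :
    (((List.ofFn fun l => (elimList H σ l).map fun j => (j.val : ℤ)).take l).flatten.length : ℕ) =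
      bagStart H σ l := by
  induction l with
  | zero => simp [bagStart]
  | succ l ih =>
    rw [length_flatten_take_succ _ (by simpa using hl), ih (by omega), bagStart_succ, bag,
      dif_pos (by omega)]
    simp

/-- The data that do not depend on the rows of the matrix. -/
def setup : Prog := .block [
  .assign 4 (.add (.add (.reg 2) (.reg 2)) (.const 1)),
  .assign 5 (.const 1),
  .loop 16 0 (.assign 5 (.add (.reg 5) (.reg 2))),
  .write 7 (.const 0) (.const 1),
  .loop 16 0 (.block [
    .assign 17 (.const 0),
    .loop 18 4 (.assign 17 (.add (.reg 17) (.read 7 (.reg 16)))),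
    .write 7 (.add (.reg 16) (.const 1)) (.reg 17)]),
  .loop 16 0 (.write 8 (.read 3 (.reg 16)) (.reg 16)),
  .loop 16 0 (.block [
    .write 9 (.reg 16) (.sub (.read 4 (.add (.reg 16) (.const 1))) (.read 4 (.reg 16))),
    .write 10 (.add (.reg 16) (.const 1))
      (.add (.read 10 (.reg 16)) (.read 7 (.read 9 (.reg 16))))])]

theorem wp_setup (hn : 0 < n) :
    WP setup (inputMemory A g H σ) fun M' t =>
      Env g (2 * g + 1) H σ M' ∧ t ≤ 300 * (n * (2 * g + 1)) := by
  set M := inputMemory A g H σ with hM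
  have i0 : M.reg 0 = n := rfl
  have i2 : M.reg 2 = g := rfl
  have a3 : ∀ l (hl : l < n), M.arr 3 l = (σ ⟨l, hl⟩ : ℕ) :=
    fun l hl => vecArr_natCast (fun l => ((σ l).val : ℤ)) ⟨l, hl⟩
  have a4 : ∀ l ≤ n, M.arr 4 l = bagStart H σ l := by
    intro l hl
    rw [← length_flatten_take_elimList hl]
    exact listArr_offsets _ (by simpa using hl)
  have a5 : ∀ l k (hk : k < (bag H σ l).length),
      M.arr 5 (bagStart H σ l + k) = ((bag H σ l)[k] : ℕ) := by
    intro l k hk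
    have hl : l < n := by
      by_contra h
      simp [bag_of_le (not_lt.1 h)] at hk
    have hb : bag H σ l = elimList H σ ⟨l, hl⟩ := dif_pos hl
    rw [← length_flatten_take_elimList hl.le]
    refine (listArr_flatten _ (by simpa using hl) (by simpa [← hb] using hk)).trans ?_
    simp [hb]
  -- The length of the root bag and the start of the first table are never written; they rely on
  -- memory being zero initially.
  have a9 : M.arr 9 n = 0 := rfl
  have a10 : M.arr 10 0 = 0 := rfl
  clear_value M
  simp only [setup, wp_block_cons, wp_block_one, wp_assign, Expr.eval, i2, Expr.cost]
  refine wp_loop n (fun k M' => M'.reg 5 = k * g + 1) (fun k => 12 * k) (by simp [i0]) (by simp)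
    ?_ ?_
  · intro k hk M₁ hs₁ hik hI
    have h2 : M₁.reg 2 = g := by rw [hs₁.reg 2 (by decide)]; simp [i2]
    simp only [wp_assign, Expr.eval, Expr.cost, hI, h2, reg_setReg, Nat.reduceEqDiff, ↓reduceIte]
    exact ⟨by push_cast; ring, by omega⟩
  intro M₁ t₁ hs₁ h5 ht₁
  have g0 : M₁.reg 0 = n := by rw [hs₁.reg 0 (by decide)]; simp [i0]
  have g4 : M₁.reg 4 = (2 * g + 1 : ℕ) := by
    rw [hs₁.reg 4 (by decide)]
    simp only [reg_setReg, Nat.reduceEqDiff, ↓reduceIte]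
    push_cast
    ring
  have harr₁ : M₁.arr = M.arr := by
    ext a : 1
    rw [hs₁.arr a (by simp [Prog.loop, Prog.arrs])]
    simp
  have g2 : M₁.reg 2 = g := by rw [hs₁.reg 2 (by decide)]; simp [i2]
  simp only [wp_write, Expr.eval, Expr.cost]
  -- Each power is obtained by adding the previous one `2 * g + 1` times.
  refine wp_loop n (fun k M' => ∀ j ≤ k, M'.arr 7 j = ((2 * g + 1 : ℕ) : ℤ) ^ j)
    (fun k => (30 + 20 * (2 * g + 1)) * k) (by simp [g0]) ?_ ?_ ?_
  · simp
  · intro k hk M₂ hs₂ hik hI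
    have h4 : M₂.reg 4 = (2 * g + 1 : ℕ) := by
      rw [hs₂.reg 4 (by decide)]
      simpa using g4
    simp only [wp_block_cons, wp_block_one, wp_assign, wp_write, Expr.eval, Expr.cost]
    refine wp_loop (2 * g + 1) (fun j M' => M'.reg 17 = j * ((2 * g + 1 : ℕ) : ℤ) ^ k)
      (fun j => 20 * j) (by simpa using h4) (by simp) ?_ ?_
    · intro j hj M₃ hs₃ hij hJ
      have r16 : M₃.reg 16 = k := by
        rw [hs₃.reg 16 (by decide)]
        simpa using hik
      have r7 : M₃.arr 7 = M₂.arr 7 := by rw [hs₃.arr 7 (by decide)]; simp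
      simp only [wp_assign, Expr.eval, Expr.cost, hJ, r16, r7, hI k le_rfl, reg_setReg,
        Nat.reduceEqDiff, ↓reduceIte]
      exact ⟨by push_cast; ring, by omega⟩
    · intro M₃ t₃ hs₃ hJ ht₃
      have r16 : M₃.reg 16 = k := by
        rw [hs₃.reg 16 (by decide)]
        simpa using hik
      have r7 : M₃.arr 7 = M₂.arr 7 := by rw [hs₃.arr 7 (by decide)]; simp
      refine ⟨fun j hj => ?_, ?_⟩
      · simp only [arr_setReg, arr_setArr, if_true, Function.update_apply, r16, r7, hJ]
        split_ifs with h
        · have : j = k + 1 := by omega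
          rw [this, pow_succ]
          ring
        · exact hI j (by omega)
      · have : (30 + 20 * (2 * g + 1)) * (k + 1) =
          (30 + 20 * (2 * g + 1)) * k + 30 + 20 * (2 * g + 1) := by ring
        omega
  intro M₂ t₂ hs₂ h7 ht₂
  have g0₂ : M₂.reg 0 = n := by rw [hs₂.reg 0 (by decide)]; simp [g0]
  have g3₂ : M₂.arr 3 = M.arr 3 := by rw [hs₂.arr 3 (by decide)]; simp [harr₁]
  refine wp_loop n (fun k M' => ∀ j (hj : j < n), j < k → M'.arr 8 ((σ ⟨j, hj⟩ : ℕ) : ℤ) = j)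
    (fun k => 12 * k) g0₂ (by simp) ?_ ?_
  · intro k hk M₃ hs₃ hik hI
    have r3 : M₃.arr 3 = M.arr 3 := by rw [hs₃.arr 3 (by decide), g3₂]
    simp only [wp_write, Expr.eval, Expr.cost, hik, r3, a3 k hk]
    refine ⟨fun j hj hjk => ?_, by omega⟩
    simp only [arr_setReg, arr_setArr, if_true, Function.update_apply, Nat.cast_inj, Fin.val_inj,
      σ.injective.eq_iff, Fin.mk.injEq]
    split_ifs with h
    · rw [h]
    · exact hI j hj (by omega)
  intro M₃ t₃ hs₃ h8 ht₃
  have g0₃ : M₃.reg 0 = n := by rw [hs₃.reg 0 (by decide), g0₂]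
  have g7₃ : M₃.arr 7 = M₂.arr 7 := by rw [hs₃.arr 7 (by decide)]
  have g4₃ : M₃.arr 4 = M.arr 4 := by
    rw [hs₃.arr 4 (by decide), hs₂.arr 4 (by decide)]; simp [harr₁]
  have g9₃ : M₃.arr 9 = M.arr 9 := by
    rw [hs₃.arr 9 (by decide), hs₂.arr 9 (by decide)]; simp [harr₁]
  have g10₃ : M₃.arr 10 = M.arr 10 := by
    rw [hs₃.arr 10 (by decide), hs₂.arr 10 (by decide)]; simp [harr₁]
  refine wp_loop n (fun k M' => (∀ j < k, M'.arr 9 j = (bag H σ j).length) ∧ M'.arr 9 n = 0 ∧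
      ∀ j ≤ k, M'.arr 10 j = tableStart (2 * g + 1) H σ j)
    (fun k => 30 * k) g0₃ ?_ ?_ ?_
  · simp only [arr_setReg, g9₃, g10₃, a9]
    refine ⟨by simp, trivial, fun j hj => ?_⟩
    obtain rfl : j = 0 := by omega
    simpa [tableStart] using a10
  · rintro k hk M₄ hs₄ hik ⟨hI1, hI2, hI3⟩
    have r4 : M₄.arr 4 = M.arr 4 := by rw [hs₄.arr 4 (by decide), g4₃]
    have r7 : M₄.arr 7 = M₂.arr 7 := by rw [hs₄.arr 7 (by decide), g7₃]
    have e1 : ((k : ℤ) + 1) = ((k + 1 : ℕ) : ℤ) := by push_cast; rfl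
    have e2 : (bagStart H σ (k + 1) : ℤ) - bagStart H σ k = ((bag H σ k).length : ℕ) := by
      rw [bagStart_succ]
      push_cast
      ring
    simp only [wp_block_cons, wp_block_one, wp_write, Expr.eval, Expr.cost, hik, r4, r7, reg_setArr,
      arr_setArr, Nat.reduceEqDiff, ↓reduceIte, e1, a4 k hk.le, a4 (k + 1) hk, e2,
      Function.update_self, h7 _ (length_bag_le k), hI3 k le_rfl, arr_setReg]
    refine ⟨⟨fun j hj => ?_, ?_, fun j hj => ?_⟩, by omega⟩
    · rw [Function.update_apply]
      split_ifs with h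
      · rw [Nat.cast_inj.1 h]
      · exact hI1 j (by omega)
    · rw [Function.update_apply, if_neg (by omega), hI2]
    · rw [Function.update_apply]
      split_ifs with h
      · rw [Nat.cast_inj.1 h, tableStart_succ]
        push_cast
        ring
      · exact hI3 j (by omega)
  rintro M₄ t₄ hs₄ ⟨h9, h9', h10⟩ ht₄
  refine ⟨⟨?_, ?_, ?_, ?_, ?_, ?_, ?_, ?_, ?_, ?_, ?_⟩, ?_⟩
  · rw [hs₄.reg 0 (by decide), g0₃]
  · rw [hs₄.reg 2 (by decide), hs₃.reg 2 (by decide), hs₂.reg 2 (by decide)]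
    simpa using g2
  · rw [hs₄.reg 4 (by decide), hs₃.reg 4 (by decide), hs₂.reg 4 (by decide)]
    simpa using g4
  · rw [hs₄.reg 5 (by decide), hs₃.reg 5 (by decide), hs₂.reg 5 (by decide)]
    simpa using h5
  · rw [hs₄.arr 3 (by decide), hs₃.arr 3 (by decide), g3₂]
    exact a3
  · rw [hs₄.arr 4 (by decide), g4₃]
    exact a4
  · rw [hs₄.arr 5 (by decide), hs₃.arr 5 (by decide), hs₂.arr 5 (by decide)]
    simpa [harr₁] using a5
  · rw [hs₄.arr 7 (by decide), g7₃]
    exact h7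
  · intro v
    rw [hs₄.arr 8 (by decide)]
    simpa using h8 (σ.symm v) (Fin.is_lt _) (Fin.is_lt _)
  · intro l hl
    rcases hl.lt_or_eq with h | rfl
    · exact h9 l h
    · simpa [bag_of_le le_rfl] using h9'
  · exact h10
  · have e : (30 + 20 * (2 * g + 1)) * n = 30 * n + 20 * (n * (2 * g + 1)) := by ring
    have h1 : n ≤ n * (2 * g + 1) := Nat.le_mul_of_pos_right n (by omega)
    omega

/-- The number of nonzero entries of `A` above row `i`. -/
def rowStart (A : Matrix (Fin m) (Fin n) ℤ) (i : ℕ) : ℕ :=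
  ∑ k ∈ Finset.range i, if h : k < m then (rowSupport A ⟨k, h⟩).length else 0

/-- The memory holds the rows of `A`. -/
structure Rows (A : Matrix (Fin m) (Fin n) ℤ) (M : Memory) : Prop where
  start : ∀ i ≤ m, M.arr 0 i = rowStart A i
  column : ∀ (i : Fin m) k (hk : k < (rowSupport A i).length),
    M.arr 1 (rowStart A i + k) = ((rowSupport A i)[k] : ℕ)
  entry : ∀ (i : Fin m) k (hk : k < (rowSupport A i).length),
    M.arr 2 (rowStart A i + k) = A i (rowSupport A i)[k]

theorem Rows.of_low {M M' : Memory} (h : Rows A M) (hM : Low M M') : Rows A M' := by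
  constructor
  · rw [hM.2 0 (by norm_num)]; exact h.start
  · rw [hM.2 1 (by norm_num)]; exact h.column
  · rw [hM.2 2 (by norm_num)]; exact h.entry

theorem rowStart_succ (i : Fin m) :
    rowStart A (i + 1) = rowStart A i + (rowSupport A i).length := by
  rw [rowStart, Finset.sum_range_succ, dif_pos i.is_lt]
  rfl

theorem length_flatten_take_rows (f : Fin m → Fin n → ℤ) {i : ℕ} (hi : i ≤ m) :
    (((List.ofFn fun i => (rowSupport A i).map (f i)).take i).flatten.length : ℕ) =
      rowStart A i := by
  induction i with
  | zero => simp [rowStart]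
  | succ i ih =>
    rw [length_flatten_take_succ _ (by simpa using hi), ih (by omega), rowStart_succ ⟨i, hi⟩]
    simp

theorem rows_inputMemory : Rows A (inputMemory A g H σ) := by
  constructor
  · intro i hi
    rw [← length_flatten_take_rows (fun _ j => (j.val : ℤ)) hi]
    exact listArr_offsets _ (by simpa using hi)
  · intro i k hk
    rw [← length_flatten_take_rows (fun _ j => (j.val : ℤ)) i.is_lt.le]
    refine (listArr_flatten _ (by simp) (by simpa using hk)).trans ?_
    simp
  · intro i k hk
    rw [← length_flatten_take_rows (fun i j => A i j) i.is_lt.le]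
    refine (listArr_flatten _ (by simp) (by simpa using hk)).trans ?_
    simp

end

/-! ### The rows of the matrix as penalties -/

section

variable {m n g N W : ℕ} {H : SimpleGraph (Fin n)} {σ : Equiv.Perm (Fin n)}
  {A : Matrix (Fin m) (Fin n) ℤ}

theorem mem_rowSupport {i : Fin m} {v : Fin n} : v ∈ rowSupport A i ↔ A i v ≠ 0 := by
  simp [rowSupport]

theorem nodup_rowSupport (i : Fin m) : (rowSupport A i).Nodup :=
  (List.nodup_finRange n).filter _

/-- Copy row number `reg 60` of the matrix to array `17`, set `reg 16` to the number of a bag that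
contains its support, and array `18` at `0` to the value of the row at the vector with all entries
`-g`. -/
def loadRow : Prog := .block [
  .assign 24 (.read 0 (.reg 60)),
  .assign 25 (.sub (.read 0 (.add (.reg 60) (.const 1))) (.reg 24)),
  .assign 16 (.reg 0),
  .assign 61 (.const 0),
  .loop 62 25 (.block [
    .assign 63 (.read 1 (.add (.reg 24) (.reg 62))),
    .assign 64 (.read 2 (.add (.reg 24) (.reg 62))),
    .write 17 (.reg 63) (.reg 64),
    .assign 61 (.sub (.reg 61) (.reg 64)),
    .ite (.read 8 (.reg 63)) (.reg 16) (.assign 16 (.read 8 (.reg 63))) .skip]),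
  .write 18 (.const 0) (.const 0),
  .loop 65 2 (.write 18 (.const 0) (.add (.read 18 (.const 0)) (.reg 61)))]

/-- The columns in the support of a row are pairwise adjacent in `H`, so all of them lie in the bag
of the one that comes first in the ordering. For a zero row the search keeps its initial value `n`,
and the root bag serves. -/
theorem wp_loadRow {M : Memory} (hA : columnGraph A ≤ H) (hE : Env g N H σ M) (hR : Rows A M)
    (i : Fin m) (hreg : M.reg 60 = (i : ℕ)) (h0 : ∀ v : Fin n, M.arr 17 v = 0) :
    WP loadRow M fun M' t =>
      M'.reg 24 = rowStart A i ∧ M'.reg 25 = (rowSupport A i).length ∧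
      (∃ p ≤ n, M'.reg 16 = p ∧ ∀ v ∈ rowSupport A i, v ∈ bag H σ p) ∧
      (∀ v : Fin n, M'.arr 17 v = A i v) ∧ M'.arr 18 0 = -(g * ∑ v, A i v) ∧
      t ≤ 60 + 60 * (rowSupport A i).length + 20 * g := by
  have hst := hR.start (i + 1) i.is_lt
  rw [rowStart_succ, Nat.cast_add, Nat.cast_add, Nat.cast_one] at hst
  simp only [loadRow, wp_block_cons, wp_block_one, wp_assign, Expr.eval, reg_setReg, hreg,
    arr_setReg, hE.dim, hR.start i i.is_lt.le, hst, Expr.cost, Nat.reduceEqDiff, ↓reduceIte,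
    add_sub_cancel_left]
  set L := rowSupport A i with hL
  refine wp_loop L.length (fun k M' =>
      (∃ p ≤ n, M'.reg 16 = p ∧ (∀ v ∈ L.take k, p ≤ (σ.symm v : ℕ)) ∧
        (p = n ∨ ∃ v ∈ L, (σ.symm v : ℕ) = p)) ∧
      (∀ v : Fin n, M'.arr 17 v = if v ∈ L.take k then A i v else 0) ∧
      M'.reg 61 = -((L.take k).map fun v => A i v).sum)
    (fun k => 60 * k) (by simp) ?_ ?_ ?_
  · refine ⟨⟨n, le_rfl, by simp, by simp, Or.inl rfl⟩, ?_, by simp⟩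
    simpa using h0
  · rintro k hk M₁ hs₁ hik ⟨⟨p, hpn, h16, hp, hp'⟩, h17, h61⟩
    have r24 : M₁.reg 24 = rowStart A i := by rw [hs₁.reg 24 (by decide)]; simp
    have r1 : M₁.arr 1 = M.arr 1 := by rw [hs₁.arr 1 (by decide)]; simp
    have r2 : M₁.arr 2 = M.arr 2 := by rw [hs₁.arr 2 (by decide)]; simp
    have r8 : M₁.arr 8 = M.arr 8 := by rw [hs₁.arr 8 (by decide)]; simp
    have hcol : M.arr 1 (rowStart A i + k) = (L[k] : ℕ) := hR.column i k hk
    have hent : M.arr 2 (rowStart A i + k) = A i L[k] := hR.entry i k hk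
    have A17 : ∀ v : Fin n, Function.update (M₁.arr 17) ((L[k] : ℕ) : ℤ) (A i L[k]) v =
        if v ∈ L.take (k + 1) then A i v else 0 := by
      intro v
      simp only [Function.update_apply, List.take_succ_eq_append_getElem hk, Nat.cast_inj,
        Fin.val_inj, h17, List.mem_append, List.mem_singleton]
      by_cases h : v = L[k]
      · simp [h]
      · simp [h]
    have A61 : -((L.take k).map fun v => A i v).sum - A i L[k] =
        -((L.take (k + 1)).map fun v => A i v).sum := by
      rw [List.take_succ_eq_append_getElem hk]
      simp only [List.map_append, List.map_singleton, List.sum_append, List.sum_singleton]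
      ring
    have hmem : ∀ v ∈ L.take (k + 1), v ∈ L.take k ∨ v = L[k] := by
      intro v hv
      rw [List.take_succ_eq_append_getElem hk] at hv
      simpa only [List.mem_append, List.mem_singleton] using hv
    simp only [wp_block_cons, wp_block_one, wp_assign, wp_write, wp_ite, wp_skip, Expr.eval,
      reg_setReg, arr_setReg, reg_setArr, arr_setArr, Expr.cost, Nat.reduceEqDiff, ↓reduceIte,
      hik, r24, r1, r2, r8, hcol, hent, hE.position, h16, h61]
    split_ifs with h
    · refine ⟨⟨⟨σ.symm L[k], (Fin.is_lt _).le, rfl, fun v hv => ?_,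
        Or.inr ⟨L[k], by simp, rfl⟩⟩, A17, A61⟩, by omega⟩
      rcases hmem v hv with hv | rfl
      · have := hp v hv
        omega
      · exact le_rfl
    · refine ⟨⟨⟨p, hpn, rfl, fun v hv => ?_, hp'⟩, A17, A61⟩, by omega⟩
      rcases hmem v hv with hv | rfl
      · exact hp v hv
      · omega
  rintro M₁ t₁ hs₁ ⟨⟨p, hpn, h16, hp, hp'⟩, h17, h61⟩ ht₁
  rw [List.take_length] at hp h17 h61
  have hsum : (L.map fun v => A i v).sum = ∑ v, A i v := by
    rw [← List.sum_toFinset _ (nodup_rowSupport i)]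
    refine Finset.sum_subset (Finset.subset_univ _) fun v _ hv => ?_
    by_contra h
    exact hv (by simpa [hL] using mem_rowSupport.2 h)
  rw [hsum] at h61
  simp only [wp_write, Expr.eval, Expr.cost]
  -- Multiplication by `g` through repeated addition; its cost is within budget because `g` is at
  -- most the radix.
  refine wp_loop g (fun k M' => M'.arr 18 0 = -(k * ∑ v, A i v)) (fun k => 20 * k)
    ?_ (by simp) ?_ ?_
  · rw [reg_setArr, hs₁.reg 2 (by decide)]
    simp [hE.bound]
  · intro k hk M₂ hs₂ hik hI
    have r61 : M₂.reg 61 = -∑ v, A i v := by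
      rw [hs₂.reg 61 (by decide)]
      simpa using h61
    simp only [wp_write, Expr.eval, Expr.cost, hI, r61, arr_setReg, arr_setArr, ↓reduceIte,
      Function.update_self]
    exact ⟨by push_cast; ring, by omega⟩
  intro M₂ t₂ hs₂ hI ht₂
  refine ⟨?_, ?_, ⟨p, hpn, ?_, fun v hv => ?_⟩, fun v => ?_, hI, by omega⟩
  · rw [hs₂.reg 24 (by decide), reg_setArr, hs₁.reg 24 (by decide)]
    simp
  · rw [hs₂.reg 25 (by decide), reg_setArr, hs₁.reg 25 (by decide)]
    simp
  · rw [hs₂.reg 16 (by decide), reg_setArr, h16]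
  · have hle := hp v hv
    rcases hp' with rfl | ⟨u, hu, rfl⟩
    · have := (σ.symm v).is_lt
      omega
    rw [mem_bag]
    refine ⟨Fin.is_lt _, ?_⟩
    simp only [Fin.eta, Equiv.apply_symm_apply]
    by_cases huv : v = u
    · exact Or.inl (by rw [huv])
    · refine Or.inr ⟨lt_of_le_of_ne hle fun h => huv (σ.symm.injective h.symm), hA ?_⟩
      exact ⟨Ne.symm huv, i, mul_ne_zero (mem_rowSupport.1 hu) (mem_rowSupport.1 hv)⟩
  · rw [hs₂.arr 17 (by decide), arr_setArr, if_neg (by norm_num), h17]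
    split_ifs with h
    · rfl
    · by_contra h'
      exact h (mem_rowSupport.2 (Ne.symm h'))

/-- Subtract `reg 5` from the entries of the table of bag number `reg 16` in array `16` at which
array `18` is not zero. -/
def penalize : Prog := .block [
  .assign 47 (.read 10 (.reg 16)),
  .assign 48 (.read 7 (.read 9 (.reg 16))),
  .loop 49 48 (.block [
    .assign 66 (.read 16 (.add (.reg 47) (.reg 49))),
    .assign 67 (.read 18 (.reg 49)),
    .ite (.reg 67) (.const 0) (.assign 66 (.sub (.reg 66) (.reg 5)))
      (.ite (.const 0) (.reg 67) (.assign 66 (.sub (.reg 66) (.reg 5))) .skip),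
    .write 16 (.add (.reg 47) (.reg 49)) (.reg 66)])]

theorem wp_penalize {M : Memory} (hE : Env g N H σ M) {p : ℕ} (hp : p ≤ n)
    (hreg : M.reg 16 = p) :
    WP penalize M fun M' t =>
      (∀ l q, q < N ^ (bag H σ l).length →
        M'.arr 16 ((tableStart N H σ l + q : ℕ) : ℤ) =
          M.arr 16 ((tableStart N H σ l + q : ℕ) : ℤ) +
            if l = p then (if M.arr 18 q = 0 then 0 else -(n * g + 1 : ℤ)) else 0) ∧
      t ≤ 20 + 50 * N ^ (bag H σ p).length := by
  have hlen := length_bag_le (H := H) (σ := σ) p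
  -- The penalty is made opaque, so that `split_ifs` later splits on the branches of the program and
  -- not on this conditional.
  obtain ⟨P, hP⟩ : ∃ P : ℤ → ℤ, ∀ t, P t = if t = 0 then 0 else -(n * g + 1 : ℤ) := ⟨_, fun _ => rfl⟩
  simp only [← hP]
  simp only [penalize, wp_block_cons, wp_block_one, wp_assign, Expr.eval, reg_setReg, hreg,
    arr_setReg, hE.table p hp, hE.length p hp, hE.pow _ hlen, Expr.cost, Nat.reduceEqDiff,
    ↓reduceIte]
  refine wp_loop (N ^ (bag H σ p).length)
    (fun k M' => ∀ a : ℕ, M'.arr 16 a = M.arr 16 a +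
      if tableStart N H σ p ≤ a ∧ a < tableStart N H σ p + k
      then P (M.arr 18 ((a - tableStart N H σ p : ℕ) : ℤ))
      else 0) (fun k => 50 * k)
    (by simp) ?_ ?_ ?_
  · intro a
    simp only [arr_setReg, add_zero]
    rw [if_neg (by omega), add_zero]
  · intro k hk M₁ hs hik hI
    have h47 : M₁.reg 47 = tableStart N H σ p := by rw [hs.reg 47 (by decide)]; simp
    have h5 : M₁.reg 5 = n * g + 1 := by rw [hs.reg 5 (by decide)]; simp [hE.penalty]
    have h18 : M₁.arr 18 = M.arr 18 := by rw [hs.arr 18 (by decide)]; simp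
    have key : ∀ x : ℤ, x = M₁.arr 16 ((tableStart N H σ p : ℤ) + k) +
          P (M.arr 18 k) →
        ∀ a : ℕ, Function.update (M₁.arr 16) ((tableStart N H σ p : ℤ) + k) x a = M.arr 16 a +
        if tableStart N H σ p ≤ a ∧ a < tableStart N H σ p + (k + 1)
        then P (M.arr 18 ((a - tableStart N H σ p : ℕ) : ℤ))
        else 0 := by
      intro x hx a
      rw [Function.update_apply]
      by_cases h : a = tableStart N H σ p + k
      · subst h
        rw [if_pos (by push_cast; rfl), hx, if_pos (by omega), ← Nat.cast_add, hI,
          if_neg (by omega)]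
        simp
      · rw [if_neg (by omega), hI]
        congr 1
        by_cases h' : tableStart N H σ p ≤ a ∧ a < tableStart N H σ p + k
        · rw [if_pos h', if_pos (by omega)]
        · rw [if_neg h', if_neg (by omega)]
    simp only [wp_block_cons, wp_block_one, wp_assign, wp_write, wp_ite, wp_skip, Expr.eval,
      reg_setReg, arr_setReg, arr_setArr, Expr.cost, Nat.reduceEqDiff, ↓reduceIte,
      h47, h5, h18, hik]
    split_ifs with h h'
    · exact ⟨key _ (by rw [hP, if_neg (by omega)]; ring), by omega⟩
    · exact ⟨key _ (by rw [hP, if_neg (by omega)]; ring), by omega⟩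
    · exact ⟨key _ (by rw [hP, if_pos (by omega)]; ring), by omega⟩
  · intro M₁ t hs hI ht
    refine ⟨fun l q hq => ?_, by omega⟩
    rw [hI]
    congr 1
    simp only [tableStart_add_mem hq]
    by_cases h : l = p
    · subst h
      simp
    · simp [h]

/-- Penalize the assignments that violate row number `reg 60`. -/
def addRow : Prog := .block [loadRow, fill, penalize, clear 1]

/-- Coefficients outside the chosen bag vanish, so the tabulated number is the value of the entire
row. Only the sum over all tables is recorded, because the choice of the bag is irrelevant
afterwards. -/
theorem wp_addRow {M : Memory} (hA : columnGraph A ≤ H) (hE : Env g N H σ M) (hR : Rows A M)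
    (hN : 0 < N) (hgN : g ≤ N) (hNW : N ≤ W)
    (hW : ∀ l, (bag H σ l).length ≤ W ∧ N ^ (bag H σ l).length ≤ W)
    (i : Fin m) (hreg : M.reg 60 = (i : ℕ)) (h0 : ∀ v : Fin n, M.arr 17 v = 0) :
    WP addRow M fun M' t =>
      (∀ v : Fin n, M'.arr 17 v = 0) ∧
      (∀ d : Fin n → ℕ, (∀ v, d v < N) →
        ∑ l ∈ Finset.Icc 0 n, M'.arr 16 ((tableStart N H σ l + enc N d (bag H σ l) : ℕ) : ℤ) =
        ∑ l ∈ Finset.Icc 0 n, M.arr 16 ((tableStart N H σ l + enc N d (bag H σ l) : ℕ) : ℤ) +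
          if ∑ v, A i v * ((d v : ℤ) - g) = 0 then 0 else -(n * g + 1 : ℤ)) ∧
      t ≤ 1000 * W := by
  have hW1 : 1 ≤ W := hN.trans_le hNW
  simp only [addRow, wp_block_cons, wp_block_one]
  refine (wp_loadRow hA hE hR i hreg h0).mono ?_
  rintro M₁ t₁ hs₁ ⟨h24, h25, ⟨p, hpn, h16, hp⟩, h17, h18, ht₁⟩
  have hE₁ := hE.of_low hs₁.low
  have hR₁ := hR.of_low hs₁.low
  refine (wp_fill hE₁ hN hpn h16 h17 h18).mono ?_
  rintro M₂ t₂ hs₂ ⟨hT, ht₂⟩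
  have hE₂ := hE₁.of_low hs₂.low
  have hR₂ := hR₁.of_low hs₂.low
  refine (wp_penalize hE₂ hpn ?_).mono ?_
  · rw [hs₂.reg 16 (by decide), h16]
  rintro M₃ t₃ hs₃ ⟨hpen, ht₃⟩
  have hR₃ := hR₂.of_low hs₃.low
  refine (wp_clear (L := rowSupport A i) (s := rowStart A i) (by norm_num) ?_ ?_
    (hR₃.column i) ?_).mono ?_
  · rw [hs₃.reg 24 (by decide), hs₂.reg 24 (by decide), h24]
  · rw [hs₃.reg 25 (by decide), hs₂.reg 25 (by decide), h25]
  · intro v hv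
    rw [hs₃.arr 17 (by decide), hs₂.arr 17 (by decide), h17]
    by_contra h
    exact hv (mem_rowSupport.2 h)
  rintro M₄ t₄ hs₄ ⟨h17', ht₄⟩
  refine ⟨h17', fun d hd => ?_, ?_⟩
  · have e16 : M₂.arr 16 = M.arr 16 := by
      rw [hs₂.arr 16 (by decide), hs₁.arr 16 (by decide)]
    rw [hs₄.arr 16 (by decide), Finset.sum_congr rfl fun l _ => hpen l _ (enc_lt hd _),
      Finset.sum_add_distrib, Finset.sum_ite_eq', if_pos (by simpa using hpn), e16,
      hT _ (enc_lt hd _), lin_enc hd, ← List.sum_toFinset _ (nodup_bag _)]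
    have hsum : ∑ v ∈ (bag H σ p).toFinset, A i v * (d v : ℤ) = ∑ v, A i v * (d v : ℤ) := by
      refine Finset.sum_subset (Finset.subset_univ _) fun v _ hv => ?_
      have : A i v = 0 := by
        by_contra h
        exact hv (by simpa using hp v (mem_rowSupport.2 h))
      rw [this, zero_mul]
    -- The initial table entry accounts for the shift between digits in [0, 2g] and entries in [-g,
    -- g].
    have e : -(g * ∑ v, A i v) + ∑ v, A i v * (d v : ℤ) = ∑ v, A i v * ((d v : ℤ) - g) := by
      simp only [mul_sub, Finset.sum_sub_distrib, ← Finset.sum_mul]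
      ring
    rw [hsum, e]
  · have a1 := hW p
    have a2 : (rowSupport A i).length ≤ (bag H σ p).length :=
      ((nodup_rowSupport i).subperm fun v hv => hp v hv).length_le
    omega

end

section

variable {m n g N W : ℕ} {H : SimpleGraph (Fin n)} {σ : Equiv.Perm (Fin n)}
  {A : Matrix (Fin m) (Fin n) ℤ}

/-- The penalties for the rows of `A` that the vector with the entries `d v - g` violates. -/
def penalty (A : Matrix (Fin m) (Fin n) ℤ) (g : ℕ) (d : Fin n → ℕ) : ℤ :=
  ∑ i, if ∑ v, A i v * ((d v : ℤ) - g) = 0 then 0 else -(n * g + 1 : ℤ)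

/-- The preprocessing program. -/
def prep : Prog :=
  .ite (.const 0) (.reg 2) (.seq setup (.loop 60 1 addRow)) .skip

theorem wp_prep (hA : columnGraph A ≤ H) (hn : 0 < n) (hg : 0 < g) (hNW : 2 * g + 1 ≤ W)
    (hW : ∀ l, (bag H σ l).length ≤ W ∧ (2 * g + 1) ^ (bag H σ l).length ≤ W) :
    WP prep (inputMemory A g H σ) fun M t =>
      Env g (2 * g + 1) H σ M ∧ (∀ v : Fin n, M.arr 17 v = 0) ∧
      (∀ d : Fin n → ℕ, (∀ v, d v < 2 * g + 1) → ∑ l ∈ Finset.Icc 0 n,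
        M.arr 16 ((tableStart (2 * g + 1) H σ l + enc (2 * g + 1) d (bag H σ l) : ℕ) : ℤ) =
          penalty A g d) ∧
      t ≤ 2000 * ((m + n) * W) := by
  have h2 : (inputMemory A g H σ).reg 2 = g := rfl
  simp only [prep, wp_ite, Expr.eval, h2, Nat.cast_pos, hg, if_true, wp_seq, Expr.cost]
  refine (wp_setup hn).mono ?_
  rintro M₁ t₁ hs₁ ⟨hE, ht₁⟩
  have hR : Rows A M₁ := by
    have h := rows_inputMemory (A := A) (g := g) (H := H) (σ := σ)
    constructor
    · rw [hs₁.arr 0 (by decide)]; exact h.start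
    · rw [hs₁.arr 1 (by decide)]; exact h.column
    · rw [hs₁.arr 2 (by decide)]; exact h.entry
  have h1 : M₁.reg 1 = m := by rw [hs₁.reg 1 (by decide)]; rfl
  -- The penalty tables need no initialization: unused memory is zero.
  have h16 : ∀ a, M₁.arr 16 a = 0 := by rw [hs₁.arr 16 (by decide)]; exact fun _ => rfl
  have h17 : ∀ a, M₁.arr 17 a = 0 := by rw [hs₁.arr 17 (by decide)]; exact fun _ => rfl
  refine wp_loop m (fun k M => (∀ v : Fin n, M.arr 17 v = 0) ∧
      ∀ d : Fin n → ℕ, (∀ v, d v < 2 * g + 1) → ∑ l ∈ Finset.Icc 0 n,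
        M.arr 16 ((tableStart (2 * g + 1) H σ l + enc (2 * g + 1) d (bag H σ l) : ℕ) : ℤ) =
          ∑ i with i.val < k,
            if ∑ v, A i v * ((d v : ℤ) - g) = 0 then 0 else -(n * g + 1 : ℤ))
    (fun k => (1000 * W + 7) * k) h1 ?_ ?_ ?_
  · simp [h16, h17]
  · rintro k hk M₂ hs₂ hik ⟨hI1, hI2⟩
    have hlow := hs₂.low
    refine (wp_addRow hA (hE.of_low hlow) (hR.of_low hlow) (by omega) (by omega) hNW hW ⟨k, hk⟩ hik
      hI1).mono ?_
    rintro M₃ t₃ hs₃ ⟨h17', h16', ht₃⟩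
    refine ⟨⟨h17', fun d hd => ?_⟩, ?_⟩
    · rw [arr_setReg, h16' d hd, hI2 d hd]
      have e : (Finset.univ.filter fun i : Fin m => i.val < k + 1) =
          insert ⟨k, hk⟩ (Finset.univ.filter fun i : Fin m => i.val < k) := by
        ext i
        simp only [Finset.mem_filter, Finset.mem_univ, true_and, Finset.mem_insert, Fin.ext_iff]
        omega
      rw [e, Finset.sum_insert (by simp), add_comm]
    · have : (1000 * W + 7) * (k + 1) = (1000 * W + 7) * k + 1000 * W + 7 := by ring
      omega
  rintro M₂ t₂ hs₂ ⟨hI1, hI2⟩ ht₂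
  refine ⟨hE.of_low hs₂.low, hI1, fun d hd => ?_, ?_⟩
  · rw [hI2 d hd, penalty]
    simp
  · have e1 : (1000 * W + 7) * m = 1000 * (m * W) + 7 * m := by ring
    have e2 : m ≤ m * W := Nat.le_mul_of_pos_right m (by omega)
    have e3 : n * (2 * g + 1) ≤ n * W := Nat.mul_le_mul_left n hNW
    have e4 : n ≤ n * (2 * g + 1) := Nat.le_mul_of_pos_right n (by omega)
    have e5 : 2000 * ((m + n) * W) = 2000 * (m * W) + 2000 * (n * W) := by ring
    omega

/-! ### The test -/

/-- Set `reg 53` to the sum of the absolute values of the entries of array `6`, and `reg 54` to the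
position of one of its nonzero entries. -/
def scan : Prog := .block [
  .assign 53 (.const 0),
  .assign 54 (.const (-1)),
  .loop 55 0 (.block [
    .assign 56 (.read 6 (.reg 55)),
    .ite (.reg 56) (.const 0) (.assign 56 (.sub (.const 0) (.reg 56))) .skip,
    .assign 53 (.add (.reg 53) (.reg 56)),
    .ite (.const 0) (.reg 56) (.assign 54 (.reg 55)) .skip])]

theorem wp_scan {M : Memory} (hE : Env g N H σ M) {z : Fin n → ℤ}
    (hz : ∀ v : Fin n, M.arr 6 v = z v) :
    WP scan M fun M' t =>
      M'.reg 53 = ∑ v, |z v| ∧ (z ≠ 0 → ∃ v : Fin n, M'.reg 54 = (v : ℕ) ∧ z v ≠ 0) ∧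
      t ≤ 20 + 40 * n := by
  simp only [scan, wp_block_cons, wp_block_one, wp_assign, Expr.eval, Expr.cost]
  refine wp_loop n (fun k M' => M'.reg 53 = ∑ j ∈ Finset.range k, |M.arr 6 j| ∧
      ((∃ v : Fin n, v < k ∧ z v ≠ 0) → ∃ v : Fin n, M'.reg 54 = (v : ℕ) ∧ z v ≠ 0))
    (fun k => 40 * k) (by simp [hE.dim]) (by simp) ?_ ?_
  · rintro k hk M₁ hs₁ hik ⟨hI1, hI2⟩
    have r6 : M₁.arr 6 = M.arr 6 := by rw [hs₁.arr 6 (by decide)]; simp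
    have hzk := hz ⟨k, hk⟩
    simp only at hzk
    have hlt : (∃ v : Fin n, v.val < k + 1 ∧ z v ≠ 0) → z ⟨k, hk⟩ = 0 →
        ∃ v : Fin n, v.val < k ∧ z v ≠ 0 := by
      rintro ⟨v, hv, hv'⟩ h0
      refine ⟨v, lt_of_le_of_ne (by omega) fun h => hv' ?_, hv'⟩
      have : v = ⟨k, hk⟩ := Fin.ext h
      rw [this, h0]
    simp only [wp_block_cons, wp_block_one, wp_assign, wp_ite, wp_skip, Expr.eval,
      reg_setReg, Expr.cost, Nat.reduceEqDiff, ↓reduceIte, hik, r6, hzk, hI1,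
      Finset.sum_range_succ]
    split_ifs with h h' h'
    · exact ⟨⟨by rw [abs_of_neg h]; ring, fun _ => ⟨⟨k, hk⟩, rfl, by omega⟩⟩, by omega⟩
    · omega
    · exact ⟨⟨by rw [abs_of_pos h'], fun _ => ⟨⟨k, hk⟩, rfl, by omega⟩⟩, by omega⟩
    · exact ⟨⟨by rw [abs_of_nonneg (by omega)], fun hv => hI2 (hlt hv (by omega))⟩, by omega⟩
  · rintro M₁ t₁ hs₁ ⟨hI1, hI2⟩ ht₁
    refine ⟨?_, fun h => hI2 ?_, by omega⟩
    · rw [hI1, Finset.sum_range]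
      simp [hz]
    · obtain ⟨v, hv⟩ := Function.ne_iff.1 h
      exact ⟨v, v.is_lt, hv⟩

/-- The program that tests the vector in array `6`. -/
def test : Prog :=
  .ite (.const 0) (.reg 2)
    (.block [
      scan,
      .assign 30 (.const (-1)),
      maximize,
      .assign 57 (.reg 52),
      .assign 30 (.reg 54),
      maximize,
      .assign 3 (.const 0),
      .ite (.const 0) (.reg 53)
        (.ite (.reg 57) (.reg 53) .skip (.ite (.reg 52) (.const 1) (.assign 3 (.const 1)) .skip))
        .skip])
    (.assign 3 (.const 0))

open Classical in
-- The property `G` is kept abstract and enters only through its description by the two optima,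
-- which separates the program from the theory of Graver bases.
theorem wp_test {M : Memory} (hP : IsPerfectElimination H σ) (hE : Env g N H σ M)
    (hg : 0 < g) (hN : 0 < N) (hn : 0 < n) (hNW : N ≤ W)
    (hW : ∀ l, (bag H σ l).length ≤ W ∧ N ^ (bag H σ l).length ≤ W) {z : Fin n → ℤ}
    (hz : ∀ v : Fin n, M.arr 6 v = z v) (h0 : ∀ v : Fin n, M.arr 17 v = 0) {G : Prop}
    (hG : ∀ (J o₁ o₂ : ℤ),
      (z ≠ 0 → ∃ v : Fin n, J = (v : ℕ) ∧ z v ≠ 0) →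
      (∀ d : Fin n → ℕ, (∀ v, d v < N) →
        value N H σ (weight g z (-1)) 0 (M.arr 16) d ≤ o₁) →
      (∃ d : Fin n → ℕ, (∀ v, d v < N) ∧
        value N H σ (weight g z (-1)) 0 (M.arr 16) d = o₁) →
      (∀ d : Fin n → ℕ, (∀ v, d v < N) →
        value N H σ (weight g z J) 0 (M.arr 16) d ≤ o₂) →
      (∃ d : Fin n → ℕ, (∀ v, d v < N) ∧
        value N H σ (weight g z J) 0 (M.arr 16) d = o₂) →
      (G ↔ 0 < ∑ v, |z v| ∧ ∑ v, |z v| ≤ o₁ ∧ o₂ < 1)) :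
    WP test M fun M' t => M'.reg 3 = (if G then 1 else 0) ∧ t ≤ 3000 * (n * W) := by
  simp only [test, wp_ite, Expr.eval, hE.bound, Nat.cast_pos, hg, if_true, wp_block_cons,
    wp_block_one, Expr.cost]
  refine (wp_scan hE hz).mono ?_
  rintro M₁ t₁ hs₁ ⟨h53, h54, ht₁⟩
  have hE₁ := hE.of_low hs₁.low
  have h16₁ : M₁.arr 16 = M.arr 16 := hs₁.arr 16 (by decide)
  have h17₁ : M₁.arr 17 = M.arr 17 := hs₁.arr 17 (by decide)
  have h6₁ : M₁.arr 6 = M.arr 6 := hs₁.arr 6 (by decide)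
  rw [wp_assign]
  -- No vertex has number -1, so nothing is excluded in the first maximization.
  refine (wp_maximize (z := z) (J := -1) hP (hE₁.of_low ((Low.refl _).setReg (by norm_num) _)) hN hn
    hNW hW ?_ (by simp) ?_).mono ?_
  · rw [arr_setReg, h6₁]
    exact hz
  · rw [arr_setReg, h17₁]
    exact h0
  rintro M₂ t₂ hs₂ ⟨h17₂, hle₂, hex₂, ht₂⟩
  rw [arr_setReg, h16₁] at hle₂ hex₂
  have hE₂ := (hE₁.of_low ((Low.refl _).setReg (by norm_num) _)).of_low hs₂.low
  have h54₂ : M₂.reg 54 = M₁.reg 54 := by rw [hs₂.reg 54 (by decide)]; simp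
  simp only [wp_assign, Expr.eval, reg_setReg, Nat.reduceEqDiff, ↓reduceIte, h54₂]
  have hlow₂ : Low M₂ ((M₂.setReg 57 (M₂.reg 52)).setReg 30 (M₁.reg 54)) :=
    ((Low.refl _).setReg (by norm_num) _).setReg (by norm_num) _
  refine (wp_maximize (z := z) (J := M₁.reg 54) hP (hE₂.of_low hlow₂) hN hn
    hNW hW ?_ (by simp) ?_).mono ?_
  · rw [arr_setReg, arr_setReg, hs₂.arr 6 (by decide), arr_setReg, h6₁]
    exact hz
  · exact h17₂
  rintro M₃ t₃ hs₃ ⟨-, hle₃, hex₃, ht₃⟩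
  rw [arr_setReg, arr_setReg, hs₂.arr 16 (by decide), arr_setReg, h16₁] at hle₃ hex₃
  have key := hG _ _ _ h54 hle₂ hex₂ hle₃ hex₃
  have h53₃ : M₃.reg 53 = ∑ v, |z v| := by
    rw [hs₃.reg 53 (by decide)]
    simp only [reg_setReg, Nat.reduceEqDiff, ↓reduceIte]
    rw [hs₂.reg 53 (by decide)]
    simpa using h53
  have h57₃ : M₃.reg 57 = M₂.reg 52 := by
    rw [hs₃.reg 57 (by decide)]
    simp
  have hnW : 1 ≤ n * W := Nat.mul_pos hn (hN.trans_le hNW)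
  have hnW' : n ≤ n * W := Nat.le_mul_of_pos_right n (hN.trans_le hNW)
  simp only [wp_skip, Expr.cost, reg_setReg, ↓reduceIte, h53₃, h57₃, key]
  split_ifs <;> omega

end

/-! ### Graver bases and the two optima -/

section

variable {m n g : ℕ} {A : Matrix (Fin m) (Fin n) ℤ} {z : Fin n → ℤ}

theorem conformal_iff {x y : ℤ} :
    (0 ≤ x ∧ x ≤ y) ∨ (y ≤ x ∧ x ≤ 0) ↔ 0 ≤ x * y ∧ |x| ≤ |y| := by
  constructor
  · rintro (⟨h1, h2⟩ | ⟨h1, h2⟩)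
    · exact ⟨mul_nonneg h1 (h1.trans h2), by rwa [abs_of_nonneg h1, abs_of_nonneg (h1.trans h2)]⟩
    · refine ⟨mul_nonneg_of_nonpos_of_nonpos h2 (h1.trans h2), ?_⟩
      rw [abs_of_nonpos h2, abs_of_nonpos (h1.trans h2)]
      omega
  · rintro ⟨h1, h2⟩
    rcases mul_nonneg_iff.1 h1 with ⟨h3, h4⟩ | ⟨h3, h4⟩
    · rw [abs_of_nonneg h3, abs_of_nonneg h4] at h2
      exact Or.inl ⟨h3, h2⟩
    · rw [abs_of_nonpos h3, abs_of_nonpos h4] at h2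
      exact Or.inr ⟨by omega, h3⟩

/-- The vector whose entries are the values `d v - g`. -/
def shift (g : ℕ) (d : Fin n → ℕ) : Fin n → ℤ := fun v => (d v : ℤ) - g

theorem exists_shift_eq {x : Fin n → ℤ} (hx : ∀ v, |x v| ≤ g) :
    ∃ d : Fin n → ℕ, (∀ v, d v < 2 * g + 1) ∧ shift g d = x := by
  refine ⟨fun v => (x v + g).toNat, fun v => ?_, funext fun v => ?_⟩
  · have := abs_le.1 (hx v)
    simp only
    omega
  · have := abs_le.1 (hx v)
    simp only [shift]
    omega

theorem total_of_feasible {J : ℤ} {d : Fin n → ℕ} (hA : A.mulVec (shift g d) = 0)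
    (hc : Conformal (shift g d) z) (hJ : ∀ v : Fin n, ((v : ℕ) : ℤ) = J → shift g d v ≠ z v) :
    penalty A g d + ∑ v, weight g z J v (d v) = ∑ v, |shift g d v| := by
  have h1 : penalty A g d = 0 := Finset.sum_eq_zero fun i _ => if_pos (congrFun hA i)
  rw [h1, zero_add]
  refine Finset.sum_congr rfl fun v _ => if_pos ⟨conformal_iff.2 (hc v), ?_⟩
  rintro ⟨h, h'⟩
  exact hJ v h' h

/-- Every weight is at most `g` and every row penalty is at most 0, so a single term -(n g + 1)
would already make the total negative. -/
theorem feasible_of_total_nonneg {J : ℤ} {d : Fin n → ℕ} (hd : ∀ v, d v < 2 * g + 1)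
    (h : 0 ≤ penalty A g d + ∑ v, weight g z J v (d v)) :
    A.mulVec (shift g d) = 0 ∧ Conformal (shift g d) z ∧
      ∀ v : Fin n, ((v : ℕ) : ℤ) = J → shift g d v ≠ z v := by
  have hB : (0 : ℤ) ≤ n * g := by positivity
  have hpen : ∀ i, (if ∑ v, A i v * ((d v : ℤ) - g) = 0 then 0 else -(n * g + 1 : ℤ)) ≤ 0 := by
    intro i
    split_ifs <;> omega
  have hp : penalty A g d ≤ 0 := Finset.sum_nonpos fun i _ => hpen i
  have hw : ∀ v, weight g z J v (d v) ≤ g := by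
    intro v
    have := hd v
    unfold weight
    split_ifs
    · rw [abs_le]
      omega
    · omega
  have hsum : ∑ v, weight g z J v (d v) ≤ n * g := by
    refine (Finset.sum_le_sum fun v _ => hw v).trans ?_
    simp
  have hv : ∀ v, (((0 ≤ (d v : ℤ) - g ∧ (d v : ℤ) - g ≤ z v) ∨
      (z v ≤ (d v : ℤ) - g ∧ (d v : ℤ) - g ≤ 0)) ∧
      ¬ ((d v : ℤ) - g = z v ∧ ((v : ℕ) : ℤ) = J)) := by
    intro v
    by_contra hcon
    have h1 : weight g z J v (d v) = -(n * g + 1) := if_neg hcon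
    have h2 : ∑ u ∈ Finset.univ.erase v, weight g z J u (d u) ≤ n * g := by
      refine (Finset.sum_le_sum fun u _ => hw u).trans ?_
      rw [Finset.sum_const, nsmul_eq_mul]
      have : (Finset.univ.erase v).card ≤ n := by simp
      gcongr
    have h3 := Finset.add_sum_erase Finset.univ (fun v => weight g z J v (d v))
      (Finset.mem_univ v)
    omega
  refine ⟨funext fun i => ?_, fun v => conformal_iff.1 (hv v).1, fun v hJ he => (hv v).2 ⟨he, hJ⟩⟩
  by_contra hcon
  have h1 : (if ∑ v, A i v * ((d v : ℤ) - g) = 0 then 0 else -(n * g + 1 : ℤ)) = -(n * g + 1) :=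
    if_neg hcon
  have h2 := Finset.add_sum_erase Finset.univ
    (fun i => if ∑ v, A i v * ((d v : ℤ) - g) = 0 then 0 else -(n * g + 1 : ℤ))
    (Finset.mem_univ i)
  have h3 : ∑ i ∈ Finset.univ.erase i,
      (if ∑ v, A i v * ((d v : ℤ) - g) = 0 then 0 else -(n * g + 1 : ℤ)) ≤ 0 :=
    Finset.sum_nonpos fun i _ => hpen i
  unfold penalty at h
  omega

theorem Conformal.abs_le {u v : Fin n → ℤ} (h : Conformal u v) (i : Fin n) : |u i| ≤ |v i| :=
  (h i).2

theorem Conformal.sub {u v : Fin n → ℤ} (h : Conformal u v) : Conformal (v - u) v := by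
  intro i
  have := conformal_iff.2 (h i)
  rw [← conformal_iff, Pi.sub_apply]
  omega

theorem sum_abs_pos {u : Fin n → ℤ} (h : u ≠ 0) : 0 < ∑ v, |u v| := by
  obtain ⟨v, hv⟩ := Function.ne_iff.1 h
  exact Finset.sum_pos' (fun v _ => abs_nonneg _) ⟨v, Finset.mem_univ v, abs_pos.2 hv⟩

/-- The first optimum detects whether `z` is a bounded kernel vector. The second detects a proper
conformal summand, since of two complementary summands at least one differs from `z` at `J`. -/
theorem mem_graverBasis_iff_optima (hg : ∀ v ∈ graverBasis A, ∀ j, |v j| ≤ (g : ℤ))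
    {J o₁ o₂ : ℤ} (hJ : z ≠ 0 → ∃ v : Fin n, J = (v : ℕ) ∧ z v ≠ 0)
    (hle₁ : ∀ d : Fin n → ℕ, (∀ v, d v < 2 * g + 1) →
      penalty A g d + ∑ v, weight g z (-1) v (d v) ≤ o₁)
    (hex₁ : ∃ d : Fin n → ℕ, (∀ v, d v < 2 * g + 1) ∧
      penalty A g d + ∑ v, weight g z (-1) v (d v) = o₁)
    (hle₂ : ∀ d : Fin n → ℕ, (∀ v, d v < 2 * g + 1) →
      penalty A g d + ∑ v, weight g z J v (d v) ≤ o₂)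
    (hex₂ : ∃ d : Fin n → ℕ, (∀ v, d v < 2 * g + 1) ∧
      penalty A g d + ∑ v, weight g z J v (d v) = o₂) :
    z ∈ graverBasis A ↔ 0 < ∑ v, |z v| ∧ ∑ v, |z v| ≤ o₁ ∧ o₂ < 1 := by
  constructor
  · intro hz
    obtain ⟨hAz, hz0, hmin⟩ := hz
    refine ⟨sum_abs_pos hz0, ?_, ?_⟩
    · obtain ⟨d, hd, rfl⟩ := exists_shift_eq (hg z ⟨hAz, hz0, hmin⟩)
      rw [← total_of_feasible (J := -1) hAz
        (fun v => ⟨mul_self_nonneg _, le_rfl⟩) (fun v hv => by omega)]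
      exact hle₁ d hd
    · by_contra hcon
      obtain ⟨d, hd, he⟩ := hex₂
      have hnonneg : 0 ≤ penalty A g d + ∑ v, weight g z J v (d v) := by omega
      obtain ⟨hAd, hc, hex⟩ := feasible_of_total_nonneg hd hnonneg
      rw [total_of_feasible hAd hc hex] at he
      -- The objective is the ℓ₁-norm, and it is assumed to be at least 1.
      have hne : shift g d ≠ 0 := by
        intro h
        simp [h] at he
        omega
      obtain ⟨v, hv, -⟩ := hJ hz0
      exact hex v hv.symm (congrFun (hmin _ hAd hne hc) v)
  · rintro ⟨hpos, h1, h2⟩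
    have hz0 : z ≠ 0 := by
      rintro rfl
      simp at hpos
    obtain ⟨d, hd, he⟩ := hex₁
    have hnonneg : 0 ≤ penalty A g d + ∑ v, weight g z (-1) v (d v) := by omega
    obtain ⟨hAd, hc, hex⟩ := feasible_of_total_nonneg hd hnonneg
    rw [total_of_feasible hAd hc hex] at he
    -- The ℓ₁-norms agree while the entries are bounded termwise, so all absolute values agree;
    -- conformality then fixes the signs.
    have heq : shift g d = z := by
      have h3 := (Finset.sum_eq_sum_iff_of_le fun v _ => hc.abs_le v).1
        (le_antisymm (Finset.sum_le_sum fun v _ => hc.abs_le v) (he ▸ h1))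
      funext v
      have h4 := h3 v (Finset.mem_univ v)
      have h5 := conformal_iff.2 (hc v)
      rcases abs_cases (shift g d v) with h | h <;> rcases abs_cases (z v) with h' | h' <;> omega
    have hAz : A.mulVec z = 0 := heq ▸ hAd
    have hzg : ∀ v, |z v| ≤ g := by
      intro v
      have := hd v
      rw [← heq, shift, abs_le]
      omega
    obtain ⟨j, rfl, hj⟩ := hJ hz0
    -- A nonzero conformal kernel vector that differs from `z` at `j` would be admissible in the
    -- second problem with norm at least 1.
    have key : ∀ u : Fin n → ℤ, A.mulVec u = 0 → u ≠ 0 → Conformal u z → u j = z j := by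
      intro u hu hu0 huz
      by_contra hne
      obtain ⟨e, he, rfl⟩ := exists_shift_eq fun v => (huz.abs_le v).trans (hzg v)
      have := hle₂ e he
      rw [total_of_feasible hu huz] at this
      · have := sum_abs_pos hu0
        omega
      · intro v hv
        obtain rfl : v = j := Fin.ext (by exact_mod_cast hv)
        exact hne
    refine ⟨hAz, hz0, fun u hu hu0 huz => ?_⟩
    by_contra hne
    have h3 := key u hu hu0 huz
    -- Both `u` and `z - u` would agree with `z` at `j`, which forces `z j = 0`.
    have h4 := key (z - u) (by rw [Matrix.mulVec_sub, hAz, hu, sub_zero])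
      (fun h => hne (sub_eq_zero.1 h).symm) huz.sub
    rw [Pi.sub_apply] at h4
    omega

/-- A vector conformal to `z` inherits the bound on the entries of `z`, so restricting to bounded
vectors loses nothing once `z` is bounded. -/
theorem mem_graverBasis_iff_boundedKernel (hg : ∀ v ∈ graverBasis A, ∀ j, |v j| ≤ (g : ℤ)) :
    z ∈ graverBasis A ↔ z ≠ 0 ∧ {v | v ∈ boundedKernel A g ∧ Conformal v z} = {0, z} := by
  constructor
  · intro hz
    refine ⟨hz.2.1, Set.ext fun v => ?_⟩
    simp only [Set.mem_ofPred_eq, Set.mem_insert_iff, Set.mem_singleton_iff]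
    constructor
    · rintro ⟨⟨hv, -⟩, hvz⟩
      by_cases h0 : v = 0
      · exact Or.inl h0
      · exact Or.inr (hz.2.2 v hv h0 hvz)
    · rintro (rfl | rfl)
      · exact ⟨⟨Matrix.mulVec_zero A, fun j => by simp⟩, fun i => by simp⟩
      · exact ⟨⟨hz.1, hg v hz⟩, fun i => ⟨mul_self_nonneg _, le_rfl⟩⟩
  · rintro ⟨hz0, h⟩
    have hz : z ∈ {v | v ∈ boundedKernel A g ∧ Conformal v z} := by rw [h]; simp
    refine ⟨hz.1.1, hz0, fun u hu hu0 huz => ?_⟩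
    have : u ∈ {v | v ∈ boundedKernel A g ∧ Conformal v z} :=
      ⟨⟨hu, fun j => (huz.abs_le j).trans (hz.1.2 j)⟩, huz⟩
    rw [h] at this
    simpa [hu0] using this

end

end ToricGraver

/-! ### The theorem -/

open Classical in
theorem theorem5p3 :
    ∃ (prep test : ToricGraver.Prog) (C : ℕ),
      ∀ (m n : ℕ) (A : Matrix (Fin m) (Fin n) ℤ) (g : ℕ), 0 < n →
        (∀ v ∈ ToricGraver.graverBasis A, ∀ j, |v j| ≤ (g : ℤ)) →
        ∀ (H : SimpleGraph (Fin n)) (σ : Equiv.Perm (Fin n)),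
          ToricGraver.columnGraph A ≤ H →
          ToricGraver.IsPerfectElimination H σ →
          H.cliqueNum = ToricGraver.treewidth (ToricGraver.columnGraph A) + 1 →
          ∃ (M : ToricGraver.Memory) (t : ℕ),
            ToricGraver.Runs prep (ToricGraver.inputMemory A g H σ) M t ∧
            t ≤ C * ((m + n) *
              (2 * g + 1) ^ (ToricGraver.treewidth (ToricGraver.columnGraph A) + 1)) ∧
            ∀ z : Fin n → ℤ,
              (∃ (M' : ToricGraver.Memory) (t' : ℕ),
                ToricGraver.Runs test
                  (M.setArr ToricGraver.queryArr (ToricGraver.vecArr z)) M' t' ∧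
                t' ≤ C * (n *
                  (2 * g + 1) ^ (ToricGraver.treewidth (ToricGraver.columnGraph A) + 1)) ∧
                M'.reg ToricGraver.answerReg =
                  if z ∈ ToricGraver.graverBasis A then 1 else 0) ∧
              (z ∈ ToricGraver.graverBasis A ↔
                z ≠ 0 ∧
                {v | v ∈ ToricGraver.boundedKernel A g ∧ ToricGraver.Conformal v z} = {0, z}) := by
  open ToricGraver in
  refine ⟨prep, test, 3000, fun m n A g hn hg H σ hA hP hH => ?_⟩
  rw [← hH]
  -- For `g = 0` the Graver basis is empty and the programs stop at once. They must: the time bound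
  -- then has no factor for the bag sizes, because the radix is 1.
  rcases Nat.eq_zero_or_pos g with rfl | hg0
  · refine ⟨_, _, .iteFalse (by simp [inputMemory]) (.skip _), ?_, fun z =>
      ⟨⟨_, _, .iteFalse (by simp [inputMemory]) (.assign _ _ _), ?_, ?_⟩,
        mem_graverBasis_iff_boundedKernel hg⟩⟩
    · simp
      omega
    · simp
      omega
    · rw [if_neg fun hz => hz.2.1 (funext fun j => by simpa using hg z hz j)]
      simp [answerReg]
  · set W := (2 * g + 1) ^ H.cliqueNum with hWdef
    have hW : ∀ l, (bag H σ l).length ≤ W ∧ (2 * g + 1) ^ (bag H σ l).length ≤ W := by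
      intro l
      have h : (2 * g + 1) ^ (bag H σ l).length ≤ W :=
        Nat.pow_le_pow_right (by omega) (length_bag_le_cliqueNum hP l)
      -- With a radix of at least 2, the length of a bag is dominated by the size of its table.
      exact ⟨(Nat.lt_pow_self (by omega)).le.trans h, h⟩
    have hNW : 2 * g + 1 ≤ W := Nat.le_self_pow (by omega) _
    obtain ⟨M, t, hr, hE, h17, h16, ht⟩ := wp_prep hA hn hg0 hNW hW
    refine ⟨M, t, hr, by omega, fun z => ⟨?_, mem_graverBasis_iff_boundedKernel hg⟩⟩
    have hval : ∀ (J : ℤ) (d : Fin n → ℕ), (∀ v, d v < 2 * g + 1) →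
        value (2 * g + 1) H σ (weight g z J) 0 ((M.setArr queryArr (vecArr z)).arr 16) d =
          penalty A g d + ∑ v, weight g z J v (d v) := by
      intro J d hd
      rw [arr_setArr, if_neg (by decide), value, h16 d hd]
      simp
    have hE' : Env g (2 * g + 1) H σ (M.setArr queryArr (vecArr z)) := by
      constructor
      · exact hE.dim
      · exact hE.bound
      · exact hE.radix
      · exact hE.penalty
      · exact hE.order
      · exact hE.start
      · exact hE.vertex
      · exact hE.pow
      · exact hE.position
      · exact hE.length
      · exact hE.table
    obtain ⟨M', t', hr', hans, ht'⟩ := wp_test (G := z ∈ graverBasis A) (z := z) hP hE' hg0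
      (by omega) hn hNW hW (fun v => by simp [queryArr, vecArr_natCast])
      (fun v => by simpa [queryArr] using h17 v)
      (fun J o₁ o₂ hJ hle₁ hex₁ hle₂ hex₂ => by
        refine mem_graverBasis_iff_optima hg hJ ?_ ?_ ?_ ?_
        · exact fun d hd => (hval _ d hd).ge.trans (hle₁ d hd)
        · obtain ⟨d, hd, h⟩ := hex₁
          exact ⟨d, hd, (hval _ d hd).symm.trans h⟩
        · exact fun d hd => (hval _ d hd).ge.trans (hle₂ d hd)
        · obtain ⟨d, hd, h⟩ := hex₂
          exact ⟨d, hd, (hval _ d hd).symm.trans h⟩)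
    exact ⟨M', t', hr', ht', hans⟩
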